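/- Let $K$ be a field of characteristic $0$ (for instance a subfield of $\mathbb{R}$), with algebraic closure $\overline K$, let $n\ge 1$, let $d\ge 2$ be an even integer, and let $f_1,\dots,f_m,g\in K[x_1,\dots,x_n]$ have degree at most $d$. Let $S\subset\{1,\dots,m\}$ with $s:=|S|\le n$, let $\sigma_i\in\{1,-1\}$ for $i\in S$, and put $D_s=\binom{n}{s}d^s(d-1)^{n-s}$. Let $q_0=n+1$, let $q_1<\dots<q_m$ be the first $m$ primes greater than $n+1$, let $a_{ij}=\frac{1}{q_i-j}$ for $0\le i\le m$, $0\le j\le n$, and let $T_d$ be the Chebyshev polynomial (of the first kind) of degree $d$. Put $$\tilde g=\sum_{j=1}^n a_{0j}T_d(x_j),\qquad \tilde f_i=a_{i0}+\sum_{j=1}^n a_{ij}\,(T_d(x_j)+1),$$ $$F_i=t f_i+\sigma_i(1-t)\tilde f_i\ \ (i\in S),\qquad G_j=t\,g_j+(1-t)\,\tilde g_j\ \ (1\le j\le n),$$ where $$g_j=\lambda_0\frac{\partial g}{\partial x_j}-\sum_{i\in S}\lambda_i\frac{\partial f_i}{\partial x_j},\qquad \tilde g_j=\lambda_0\frac{\partial\tilde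 g}{\partial x_j}-\sum_{i\in S}\lambda_i\sigma_i\frac{\partial\tilde f_i}{\partial x_j}.$$ Then the variety defined by the $F_i$ $(i\in S)$ and $G_1,\dots,G_n$ in $\mathbb{A}^n_{\overline{K(t)}}\times\mathbb{P}^s_{\overline{K(t)}}$, where $\mathbb{P}^s$ has the homogeneous coordinates $\lambda_0,(\lambda_i)_{i\in S}$, is zero-dimensional: it consists of exactly $D_s$ distinct points $W_1,\dots,W_{D_s}$. These all lie in $\{\lambda_0\ne 0\}$, and their projections to the $x$-space $\mathbb{A}^n$ are pairwise distinct. Moreover, these points can be considered as elements of $\overline K[[t]]^{n+s}$, lifted from $t=0$. That is, there are an embedding $\varphi$, over $K[t]$, of $\overline{K(t)}$ in an algebraic closure of $\overline K((t))$, and points $\mathcal W_1,\dots,\mathcal W_{D_s}\in\overline K[[t]]^{n+s}$, such that for every $k$ the map $\varphi$ sends the coordinates $\big(x_j,\lambda_i/\lambda_0\big)_{1\le j\le n,\ i\in S}$ of $W_k$ to those of $\mathcal W_k$. The $\mathcal W_k$ are exactly the zeros in $\overline K[[t]]^{n+s}$ of the system $F_i=0$ $(i\in S)$, $G_1=\dots=G_n=0$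 dehomogenized with $\lambda_0=1$, and $\mathcal W_k\mapsto\mathcal W_k(0)$ is a bijection from them to the zeros in $\overline K^{\,n+s}$ of the initial system $\sigma_i\tilde f_i=0$ $(i\in S)$, $\tilde g_1=\dots=\tilde g_n=0$ dehomogenized with $\lambda_0=1$. -/

import Mathlib

noncomputable section

namespace Deformation

open scoped Polynomial

/-- `q₀ = n + 1`, and `q₁ < q₂ < ⋯` are the prime numbers greater than `n + 1`, in order. -/
def q (n : ℕ) : ℕ → ℕ
  | 0 => n + 1
  | i + 1 => Nat.nth (fun p => p.Prime ∧ n + 1 < p) i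

/-- The entry `a_{ij} = 1 / (q_i - j)` of the Cauchy matrix, for `0 ≤ j ≤ n`. -/
def a (n i j : ℕ) : ℚ := 1 / ((q n i : ℚ) - (j : ℚ))

/-- The multihomogeneous Bezout number `D_s = binom(n, s) d^s (d - 1)^(n - s)`. -/
def bezoutNumber (n d s : ℕ) : ℕ := n.choose s * d ^ s * (d - 1) ^ (n - s)

section Polynomials

variable (K : Type*) [Field K] [CharZero K] (n d : ℕ)

/-- The Chebyshev polynomial `T_d` of the first kind in the variable `x_j`. -/
def cheb (j : Fin n) : MvPolynomial (Fin n) K :=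
  Polynomial.aeval (MvPolynomial.X j) (Polynomial.Chebyshev.T K (d : ℤ))

/-- `g̃ = ∑_j a_{0j} T_d(x_j)`; the coordinate `x_j` with `1 ≤ j ≤ n` is the one with the
zero-based index `j - 1`. -/
def gTilde : MvPolynomial (Fin n) K :=
  ∑ j : Fin n, MvPolynomial.C ((a n 0 (j.val + 1) : ℚ) : K) * cheb K n d j

/-- `f̃_i = a_{i0} + ∑_j a_{ij} (T_d(x_j) + 1)`, for `i ≥ 1`. -/
def fTilde (i : ℕ) : MvPolynomial (Fin n) K :=
  MvPolynomial.C ((a n i 0 : ℚ) : K) +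
    ∑ j : Fin n, MvPolynomial.C ((a n i (j.val + 1) : ℚ) : K) * (cheb K n d j + 1)

end Polynomials

section System

variable {K : Type*} [Field K] {n m : ℕ}

/-- For `p` and a family `h_i`, `i ∈ S`, of polynomials in `x`, the polynomial
`λ₀ ∂p/∂x_j - ∑_{i ∈ S} λ_i ∂h_i/∂x_j` in the variables `x` and `λ`. The variables `λ` are indexed
by `Option S`: the index `none` stands for `λ₀`, and `some i` for `λ_i`. -/
def lagrange (S : Finset (Fin m)) (p : MvPolynomial (Fin n) K) (h : S → MvPolynomial (Fin n) K)
    (j : Fin n) : MvPolynomial (Fin n ⊕ Option S) K :=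
  MvPolynomial.X (Sum.inr none) * MvPolynomial.rename Sum.inl (MvPolynomial.pderiv j p) -
    ∑ i : S, MvPolynomial.X (Sum.inr (some i)) *
      MvPolynomial.rename Sum.inl (MvPolynomial.pderiv j (h i))

/-- The deformation `t p + (1 - t) p̃`, a polynomial over `K[t]`. -/
def deform {ι : Type*} (p pTilde : MvPolynomial ι K) : MvPolynomial ι K[X] :=
  MvPolynomial.C Polynomial.X * MvPolynomial.map Polynomial.C p +
    MvPolynomial.C (1 - Polynomial.X) * MvPolynomial.map Polynomial.C pTilde

variable [CharZero K]

/-- The signed polynomials `σ_i f̃_i` for `i ∈ S`; the index `i ∈ {1, …, m}` is the element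
`i - 1` of `Fin m`. -/
def fTildeSigned (n d : ℕ) (S : Finset (Fin m)) (σ : S → ℤˣ) (i : S) : MvPolynomial (Fin n) K :=
  ((σ i : ℤ) : MvPolynomial (Fin n) K) * fTilde K n d (i.val.val + 1)

/-- `F_i^{σ_i} = t f_i + σ_i (1 - t) f̃_i`. -/
def F (d : ℕ) (f : Fin m → MvPolynomial (Fin n) K) (S : Finset (Fin m)) (σ : S → ℤˣ) (i : S) :
    MvPolynomial (Fin n) K[X] :=
  deform (f i.val) (fTildeSigned n d S σ i)

/-- The polynomial `g̃_j = λ₀ ∂g̃/∂x_j - ∑_{i ∈ S} λ_i ∂(σ_i f̃_i)/∂x_j`. -/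
def gTildeLagrange (d : ℕ) (S : Finset (Fin m)) (σ : S → ℤˣ) (j : Fin n) :
    MvPolynomial (Fin n ⊕ Option S) K :=
  lagrange S (gTilde K n d) (fTildeSigned n d S σ) j

/-- The polynomial `G_j = t g_j + (1 - t) g̃_j`, where
`g_j = λ₀ ∂g/∂x_j - ∑_{i ∈ S} λ_i ∂f_i/∂x_j`. -/
def G (d : ℕ) (f : Fin m → MvPolynomial (Fin n) K) (g : MvPolynomial (Fin n) K)
    (S : Finset (Fin m)) (σ : S → ℤˣ) (j : Fin n) : MvPolynomial (Fin n ⊕ Option S) K[X] :=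
  deform (lagrange S g (fun i => f i.val) j) (gTildeLagrange d S σ j)

/-- The algebraic set defined by the `F_i`, `i ∈ S`, and `G_1, …, G_n` in the product of the affine
`n`-space and the projective space with coordinates `λ₀, (λ_i)_{i ∈ S}` over an extension `Ω` of
the ring `K[t]`. Each `G_j` is homogeneous of degree one in `λ`, so the choice of a representative
of the projective point does not matter. -/
def variety (Ω : Type*) [Field Ω] (ρ : K[X] →+* Ω) (d : ℕ)
    (f : Fin m → MvPolynomial (Fin n) K) (g : MvPolynomial (Fin n) K)
    (S : Finset (Fin m)) (σ : S → ℤˣ) :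
    Set ((Fin n → Ω) × Projectivization Ω (Option S → Ω)) :=
  {P | (∀ i : S, MvPolynomial.eval₂ ρ P.1 (F d f S σ i) = 0) ∧
       ∀ j : Fin n, MvPolynomial.eval₂ ρ (Sum.elim P.1 P.2.rep) (G d f g S σ j) = 0}

/-- The vector of values of `λ` with `λ₀ = 1` and the given `λ_i`, `i ∈ S`. -/
def dehom {B : Type*} [One B] {S : Finset (Fin m)} (l : S → B) : Option S → B :=
  fun o => o.elim 1 l

/-- The zeros `(x, (λ_i)_{i ∈ S})` with coordinates in a ring `B` over `K[t]` of the deformed system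
dehomogenized with `λ₀ = 1`. -/
def affineZeros {B : Type*} [CommRing B] (ρ : K[X] →+* B) (d : ℕ)
    (f : Fin m → MvPolynomial (Fin n) K) (g : MvPolynomial (Fin n) K)
    (S : Finset (Fin m)) (σ : S → ℤˣ) : Set ((Fin n → B) × (S → B)) :=
  {P | (∀ i : S, MvPolynomial.eval₂ ρ P.1 (F d f S σ i) = 0) ∧
       ∀ j : Fin n, MvPolynomial.eval₂ ρ (Sum.elim P.1 (dehom P.2)) (G d f g S σ j) = 0}

/-- The zeros `(x, (λ_i)_{i ∈ S})` with coordinates in an extension `L` of `K` of the initial system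
`σ_i f̃_i`, `g̃_j`, dehomogenized with `λ₀ = 1`. -/
def initialZeros (L : Type*) [Field L] [Algebra K L] (n d : ℕ) (S : Finset (Fin m)) (σ : S → ℤˣ) :
    Set ((Fin n → L) × (S → L)) :=
  {P | (∀ i : S, MvPolynomial.aeval P.1 (fTildeSigned (K := K) n d S σ i) = 0) ∧
       ∀ j : Fin n,
         MvPolynomial.aeval (Sum.elim P.1 (dehom P.2)) (gTildeLagrange (K := K) d S σ j) = 0}

end System

section Fields

variable (K : Type*) [Field K]

/-- An algebraic closure of `K(t)`. -/
abbrev Omega : Type _ := AlgebraicClosure (RatFunc K)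

/-- The embedding of `K[t]` in the algebraic closure of `K(t)`. -/
def toOmega : K[X] →+* Omega K :=
  (algebraMap (RatFunc K) (Omega K)).comp (algebraMap K[X] (RatFunc K))

/-- The ring of formal power series over an algebraic closure of `K`. -/
abbrev Series : Type _ := PowerSeries (AlgebraicClosure K)

/-- The embedding of `K[t]` in the ring of power series over the algebraic closure of `K`. -/
def toSeries : K[X] →+* Series K :=
  (Polynomial.coeToPowerSeries.ringHom (R := AlgebraicClosure K)).comp
    (Polynomial.mapRingHom (algebraMap K (AlgebraicClosure K)))

/-- An algebraic closure of the field of formal Laurent series over an algebraic closure of `K`. -/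
abbrev BigField : Type _ := AlgebraicClosure (LaurentSeries (AlgebraicClosure K))

/-- The embedding of the power series ring in `BigField K`. -/
def seriesToBig : Series K →+* BigField K :=
  (algebraMap (LaurentSeries (AlgebraicClosure K)) (BigField K)).comp
    (HahnSeries.ofPowerSeries ℤ (AlgebraicClosure K))

/-- The value at `t = 0` of a point with power series coordinates. -/
def atZero {ι κ : Type*} (P : (ι → Series K) × (κ → Series K)) :
    (ι → AlgebraicClosure K) × (κ → AlgebraicClosure K) :=
  (fun j => PowerSeries.constantCoeff (P.1 j), fun i => PowerSeries.constantCoeff (P.2 i))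

end Fields

end Deformation

end

/-!
At `t = 0` the equation `g̃_j = 0` says that `T_d'(x_j) = 0` or that the `j`-th of `n` linear
forms in `λ` vanishes, and the equations `f̃_i = 0` are linear in the numbers `T_d(x_j) + 1`, which
are `0` or `2` at the critical points of `T_d`. The coefficients form, up to signs, a Cauchy matrix,
all minors of which are nonzero, so at most `s` of the forms vanish at once; a pole at the largest
prime `q_i`, `i ∈ S`, shows that the equations `f̃_i = 0` have no solution with fewer than `s`
non-critical coordinates. Hence every zero has exactly `s` of these. The values `T_d(x_j)` at them
and the `λ_i` are then determined by the choice of the `s` coordinates and of the critical points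
in the other ones, and they leave `d` choices for each of the `s` coordinates. This gives `D_s`
zeros, which are simple, so by Hensel's lemma each lifts to a unique zero over the power series.

For the converse, take a zero over an algebraic closure of the Laurent series field and a valuation
ring which dominates the power series ring. The zero has integral coordinates and `λ₀ ≠ 0`, since
the leading coefficients of unbounded coordinates would satisfy homogeneous equations with only the
zero solution, again by the Cauchy minors. It therefore reduces to a zero at `t = 0`, and agrees
with the lift of that zero. Finally, a system with finitely many zeros over an algebraically closed
field has no others over a larger one.
-/

namespace Deformation

open scoped Polynomial

section Cauchy

variable {k ι κ : Type*} [Field k]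

theorem eq_zero_of_sum_div_sub_eq_zero {s : Finset ι} {t : Finset κ} {x : ι → k} {y : κ → k}
    (hx : Set.InjOn x s) (hy : Set.InjOn y t) (hxy : ∀ i ∈ s, ∀ j ∈ t, x i ≠ y j)
    (hts : t.card ≤ s.card) {c : κ → k} (h : ∀ i ∈ s, ∑ j ∈ t, c j / (x i - y j) = 0) :
    ∀ j ∈ t, c j = 0 := by
  classical
  -- Up to the factor `∏ j ∈ t, (z - y j)`, the sum is the value at `z` of an interpolation
  -- polynomial of degree less than `#t`, which therefore has too many zeros.
  set P := Lagrange.interpolate t y fun j => c j / Lagrange.nodalWeight t y j with hP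
  have hPx : ∀ i ∈ s, P.eval (x i) = 0 := by
    intro i hi
    rw [hP, Lagrange.eval_interpolate_not_at_node _ (hxy i hi)]
    refine mul_eq_zero_of_right _ ((Finset.sum_congr rfl fun j hj => ?_).trans (h i hi))
    rw [mul_right_comm, mul_div_cancel₀ _ (Lagrange.nodalWeight_ne_zero hy hj), div_eq_mul_inv]
  have hdeg : P.degree < s.card :=
    (Lagrange.degree_interpolate_lt _ hy).trans_le (by exact_mod_cast hts)
  have hP0 : P = 0 := Polynomial.eq_zero_of_degree_lt_of_eval_index_eq_zero _ hx hdeg hPx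
  intro j hj
  have hPy : P.eval (y j) = c j / Lagrange.nodalWeight t y j :=
    Lagrange.eval_interpolate_at_node _ hy hj
  rw [hP0, Polynomial.eval_zero, eq_comm, div_eq_zero_iff] at hPy
  exact hPy.resolve_right (Lagrange.nodalWeight_ne_zero hy hj)

theorem sum_nodalWeight_mul_eval_div_sub [DecidableEq ι] {s : Finset ι} {x : ι → k}
    (hx : Set.InjOn x s) {p : k[X]} (hp : p.degree < s.card) {z : k} (hz : ∀ i ∈ s, z ≠ x i) :
    ∑ i ∈ s, Lagrange.nodalWeight s x i * p.eval (x i) / (x i - z) =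
      -(p.eval z / (Lagrange.nodal s x).eval z) := by
  have hpz := congrArg (Polynomial.eval z) (Lagrange.eq_interpolate hx hp)
  rw [Lagrange.eval_interpolate_not_at_node _ hz] at hpz
  rw [hpz, mul_div_cancel_left₀ _ (Lagrange.eval_nodal_not_at_node hz), ← Finset.sum_neg_distrib]
  refine Finset.sum_congr rfl fun i _ => ?_
  rw [← neg_sub z (x i), div_neg]
  ring

end Cauchy

section Nodes

theorem infinite_setOf_prime_and_lt (N : ℕ) : {p : ℕ | p.Prime ∧ N < p}.Infinite :=
  Set.infinite_of_forall_exists_gt fun b =>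
    let ⟨p, hp, hpp⟩ := Nat.exists_infinite_primes (b + N + 1)
    ⟨p, ⟨hpp, by omega⟩, by omega⟩

theorem q_succ_mem (n i : ℕ) : (q n (i + 1)).Prime ∧ n + 1 < q n (i + 1) :=
  Nat.nth_mem_of_infinite (infinite_setOf_prime_and_lt (n + 1)) i

theorem q_strictMono (n : ℕ) : StrictMono (q n) := by
  refine strictMono_nat_of_lt_succ fun i => ?_
  cases i with
  | zero => exact (q_succ_mem n 0).2
  | succ i => exact Nat.nth_strictMono (infinite_setOf_prime_and_lt (n + 1)) i.lt_succ_self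

theorem lt_q (n i : ℕ) : n < q n i :=
  n.lt_succ_self.trans_le ((q_strictMono n).monotone i.zero_le)

variable {n : ℕ} {L : Type*} [Field L] [CharZero L]

theorem cast_q_ne_cast (i : ℕ) {j : ℕ} (hj : j ≤ n) : (q n i : L) ≠ j :=
  Nat.cast_injective.ne (hj.trans_lt (lt_q n i)).ne'

theorem cast_q_injective : Function.Injective fun i => (q n i : L) :=
  Nat.cast_injective.comp (q_strictMono n).injective

theorem cast_succ_injective : Function.Injective fun j : Fin n => ((j.val + 1 : ℕ) : L) :=
  Nat.cast_injective.comp ((add_left_injective 1).comp Fin.val_injective)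

theorem cast_a (n i j : ℕ) : ((a n i j : ℚ) : L) = 1 / ((q n i : L) - j) := by
  simp [a]

variable {ι : Type*} {r : ι → ℕ} {s : Finset ι} {T : Finset (Fin n)}

theorem eq_zero_of_forall_sum_a_mul_eq_zero (hr : Set.InjOn r s) (hT : T.card ≤ s.card)
    {y : Fin n → L} (h : ∀ i ∈ s, ∑ j ∈ T, ((a n (r i) (j.val + 1) : ℚ) : L) * y j = 0) :
    ∀ j ∈ T, y j = 0 := by
  refine eq_zero_of_sum_div_sub_eq_zero (x := fun i => (q n (r i) : L))
    (cast_q_injective.comp_injOn hr) cast_succ_injective.injOn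
    (fun i _ j _ => cast_q_ne_cast (r i) j.isLt) hT fun i hi => ?_
  simpa only [cast_a, one_div_mul_eq_div] using h i hi

theorem eq_zero_of_forall_sum_mul_a_eq_zero (hr : Set.InjOn r s) (hT : s.card ≤ T.card)
    {v : ι → L} (h : ∀ j ∈ T, ∑ i ∈ s, ((a n (r i) (j.val + 1) : ℚ) : L) * v i = 0) :
    ∀ i ∈ s, v i = 0 := by
  refine eq_zero_of_sum_div_sub_eq_zero (x := fun j : Fin n => ((j.val + 1 : ℕ) : L))
    cast_succ_injective.injOn (cast_q_injective.comp_injOn hr)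
    (fun j _ i _ => (cast_q_ne_cast (r i) j.isLt).symm) hT fun j hj => ?_
  rw [← neg_eq_zero, ← h j hj, ← Finset.sum_neg_distrib]
  refine Finset.sum_congr rfl fun i _ => ?_
  rw [cast_a, one_div_mul_eq_div, ← div_neg, neg_sub, Function.comp_apply]

end Nodes

section NodalRatio

theorem padicNorm_intCast_div_le_one {p : ℕ} [Fact p.Prime] (u : ℤ) {v : ℤ} (hv : ¬(p : ℤ) ∣ v) :
    padicNorm p (u / v) ≤ 1 := by
  rw [padicNorm.div, (padicNorm.int_eq_one_iff v).mpr hv, div_one]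
  exact padicNorm.of_int u

theorem one_lt_padicNorm_intCast_div {p : ℕ} [Fact p.Prime] {u v : ℤ} (hu : ¬(p : ℤ) ∣ u)
    (hv : (p : ℤ) ∣ v) (hv0 : v ≠ 0) : 1 < padicNorm p (u / v) := by
  have hpos : 0 < padicNorm p v :=
    (padicNorm.nonneg _).lt_of_ne' (padicNorm.nonzero (Int.cast_ne_zero.mpr hv0))
  rw [padicNorm.div, (padicNorm.int_eq_one_iff u).mpr hu, one_lt_div hpos]
  exact (padicNorm.int_lt_one_iff v).mpr hv

variable {n m : ℕ} {S : Finset (Fin m)} {T : Finset (Fin n)}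

/-- The rational function `-∏_{j ∈ T} (z - j) / ∏_{i ∈ S} (z - q_i)`. When `#T < #S`, its values at
`z = 0, …, n` are a combination of the rows `i ∈ S` of the matrix `(a_{ij})`, which vanishes in the
columns of `T`. -/
noncomputable def nodalRatio (S : Finset (Fin m)) (T : Finset (Fin n)) (z : ℤ) : ℚ :=
  -((∏ j ∈ T, (z - (j.val + 1 : ℕ)) : ℤ) / (∏ i : S, (z - q n (i.val.val + 1)) : ℤ))

theorem exists_weights_sum_mul_a_eq_nodalRatio (hTS : T.card < S.card) :
    ∃ w : S → ℚ, ∀ z ≤ n, ∑ i : S, w i * a n (i.val.val + 1) z = nodalRatio S T z := by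
  classical
  set x : S → ℚ := fun i => q n (i.val.val + 1) with hx_def
  have hx : Set.InjOn x (Finset.univ : Finset S) :=
    (cast_q_injective.comp ((add_left_injective 1).comp
      (Fin.val_injective.comp Subtype.val_injective))).injOn
  set p := Lagrange.nodal T fun j => ((j.val + 1 : ℕ) : ℚ) with hp
  have hdeg : p.degree < (Finset.univ : Finset S).card := by
    rw [Lagrange.degree_nodal, Finset.card_univ, Fintype.card_coe]
    exact_mod_cast hTS
  refine ⟨fun i => Lagrange.nodalWeight Finset.univ x i * p.eval (x i), fun z hz => ?_⟩
  have key := sum_nodalWeight_mul_eval_div_sub hx hdeg (z := z)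
    fun i _ => (cast_q_ne_cast (i.val.val + 1) hz).symm
  simp only [Lagrange.eval_nodal, hp, hx_def] at key ⊢
  simp only [nodalRatio, a, mul_one_div, key]
  push_cast
  rfl

theorem nodalRatio_eq_zero {j : Fin n} (hj : j ∈ T) : nodalRatio S T (j.val + 1 : ℕ) = 0 := by
  rw [nodalRatio, Finset.prod_eq_zero hj (sub_self _), Int.cast_zero, zero_div, neg_zero]

variable {p : ℕ} [Fact p.Prime]

theorem padicNorm_nodalRatio_le_one (hp : ∀ i ∈ S, q n (i.val + 1) ≤ p) (j : Fin n) :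
    padicNorm p (nodalRatio S T (j.val + 1 : ℕ)) ≤ 1 := by
  rw [nodalRatio, padicNorm.neg]
  refine padicNorm_intCast_div_le_one _ fun hdvd => ?_
  obtain ⟨i, -, hi⟩ := (Prime.dvd_finsetProd_iff (Nat.prime_iff_prime_int.mp Fact.out) _).mp hdvd
  have hlt : j.val + 1 < q n (i.val.val + 1) := (Nat.succ_le_of_lt j.isLt).trans_lt (lt_q n _)
  have hle := Int.le_of_dvd (by omega) ((dvd_sub_comm).mp hi)
  have := hp i i.2
  omega

theorem one_lt_padicNorm_nodalRatio_zero (hnp : n < p) {i : Fin m} (hi : i ∈ S)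
    (hp : q n (i.val + 1) = p) : 1 < padicNorm p (nodalRatio S T 0) := by
  rw [nodalRatio, padicNorm.neg]
  refine one_lt_padicNorm_intCast_div (fun hdvd => ?_) ?_ ?_
  · obtain ⟨j, -, hj⟩ :=
      (Prime.dvd_finsetProd_iff (Nat.prime_iff_prime_int.mp Fact.out) _).mp hdvd
    rw [zero_sub, dvd_neg, Int.natCast_dvd_natCast] at hj
    have := Nat.le_of_dvd j.val.succ_pos hj
    omega
  · exact Dvd.dvd.trans ⟨-1, by simp [hp]⟩ (Finset.dvd_prod_of_mem _ (Finset.mem_univ ⟨i, hi⟩))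
  · refine Finset.prod_ne_zero_iff.mpr fun k _ => ?_
    have := lt_q n (k.val.val + 1)
    omega

theorem nodalRatio_zero_add_two_mul_sum_ne_zero (hS : S.Nonempty) (J : Finset (Fin n)) :
    nodalRatio S T 0 + 2 * ∑ j ∈ J, nodalRatio S T (j.val + 1 : ℕ) ≠ 0 := by
  -- At the largest of the primes `q_i`, the value at `0` has a pole, the other terms do not.
  intro hsum
  obtain ⟨i, hi, hmax⟩ := Finset.exists_max_image S Fin.val hS
  set p := q n (i.val + 1)
  have : Fact p.Prime := ⟨(q_succ_mem n _).1⟩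
  have hle : ∀ k ∈ S, q n (k.val + 1) ≤ p := fun k hk =>
    (q_strictMono n).monotone (Nat.succ_le_succ (hmax k hk))
  have hpole := one_lt_padicNorm_nodalRatio_zero (T := T) (lt_q n _) hi rfl
  rw [eq_neg_of_add_eq_zero_left hsum, padicNorm.neg, padicNorm.mul] at hpole
  refine hpole.not_ge (mul_le_one₀ (padicNorm.of_nat 2) (padicNorm.nonneg _) ?_)
  exact padicNorm.sum_le' (fun j _ => padicNorm_nodalRatio_le_one hle j) zero_le_one

end NodalRatio

section Chebyshev

open Polynomial Polynomial.Chebyshev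

theorem T_sq_add_one_sub_X_sq_mul_U_sq (R : Type*) [CommRing R] (d : ℕ) :
    T R d ^ 2 + (1 - X ^ 2) * U R (d - 1) ^ 2 = 1 := by
  induction d with
  | zero => simp
  | succ d ih =>
    have hT : T R (d + 1) = X * T R d - (1 - X ^ 2) * U R (d - 1) := by
      have h := T_eq_X_mul_T_sub_pol_U R ((d : ℤ) - 1)
      rwa [sub_add_cancel, show (d : ℤ) - 1 + 2 = d + 1 by ring] at h
    have hU : U R d = X * U R (d - 1) + T R d := by
      simpa using U_eq_X_mul_U_add_T R ((d : ℤ) - 1)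
    rw [Nat.cast_succ, add_sub_cancel_right, hT, hU]
    linear_combination ih

theorem natCard_isRoot_of_separable {L : Type*} [Field L] [IsAlgClosed L] {p : L[X]}
    (hp : p.Separable) : Nat.card {x // p.IsRoot x} = p.natDegree := by
  rw [← card_rootSet_eq_natDegree (K := L) hp (IsAlgClosed.splits _), ← Nat.card_eq_fintype_card]
  exact Nat.card_congr (Equiv.subtypeEquivRight fun x => by
    rw [mem_rootSet_of_ne hp.ne_zero, coe_aeval_eq_eval, IsRoot.def])

theorem separable_of_forall_isRoot {L : Type*} [Field L] [IsAlgClosed L] {p : L[X]}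
    (h : ∀ x, p.IsRoot x → ¬(derivative p).IsRoot x) : p.Separable := by
  rw [separable_def, isCoprime_iff_aeval_ne_zero_of_isAlgClosed L L]
  intro x
  by_cases hx : p.IsRoot x
  · exact Or.inr (by simpa only [coe_aeval_eq_eval, IsRoot.def] using h x hx)
  · exact Or.inl (by simpa only [coe_aeval_eq_eval, IsRoot.def] using hx)

theorem natDegree_T_le (R : Type*) [CommRing R] (d : ℕ) : (T R d).natDegree ≤ d := by
  rw [← map_T (Int.castRingHom R)]
  exact natDegree_map_le.trans (natDegree_T ℤ d).le

theorem coeff_T_self (R : Type*) [CommRing R] (d : ℕ) : (T R d).coeff d = 2 ^ (d - 1) := by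
  have hlead : (T ℤ d).coeff d = 2 ^ (d - 1) := by simpa [leadingCoeff] using leadingCoeff_T ℤ d
  rw [← map_T (Int.castRingHom R), coeff_map, hlead, map_pow, map_ofNat]

variable {L : Type*} [Field L] [CharZero L] {d : ℕ}

theorem eval_T_of_isRoot_derivative (hd : 0 < d) {x : L} (hx : (derivative (T L d)).IsRoot x) :
    (T L d).eval x = 1 ∨ (T L d).eval x = -1 := by
  have hU : (U L (d - 1)).eval x = 0 := by
    rw [IsRoot.def, T_derivative_eq_U, eval_mul, Int.cast_natCast, eval_natCast] at hx
    exact (mul_eq_zero.mp hx).resolve_left (Nat.cast_ne_zero.mpr hd.ne')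
  have hpell := congrArg (eval x) (T_sq_add_one_sub_X_sq_mul_U_sq L d)
  simp only [eval_add, eval_mul, eval_pow, hU, eval_one] at hpell
  exact sq_eq_one_iff.mp (by linear_combination hpell)

theorem eval_derivative_derivative_T_ne_zero (hd : 0 < d) {x : L}
    (hx : (derivative (T L d)).IsRoot x) : (derivative (derivative (T L d))).eval x ≠ 0 := by
  intro hx'
  have hode := congrArg (eval x)
    (one_sub_X_sq_mul_derivative_derivative_T_eq_poly_in_T (R := L) (d : ℤ))
  simp only [Function.iterate_succ, Function.iterate_zero, Function.comp_apply, id_eq, eval_sub,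
    eval_mul, eval_pow, hx.eq_zero, hx', Int.cast_natCast, eval_natCast, mul_zero, zero_sub,
    zero_eq_neg, mul_eq_zero, pow_eq_zero_iff two_ne_zero, Nat.cast_eq_zero, hd.ne',
    false_or] at hode
  rcases eval_T_of_isRoot_derivative hd hx with h | h <;> simp [h] at hode

variable [IsAlgClosed L]

theorem separable_derivative_T (hd : 0 < d) : (derivative (T L d)).Separable :=
  separable_of_forall_isRoot fun _ => eval_derivative_derivative_T_ne_zero hd

theorem separable_T_add_C (hd : 0 < d) {c : L} (h₁ : c ≠ 1) (h₂ : c ≠ -1) :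
    (T L d + C c).Separable := by
  refine separable_of_forall_isRoot fun x hx hx' => ?_
  rw [derivative_add, derivative_C, add_zero] at hx'
  rw [IsRoot.def, eval_add, eval_C] at hx
  rcases eval_T_of_isRoot_derivative hd hx' with h | h
  · exact h₂ (by linear_combination hx - h)
  · exact h₁ (by linear_combination hx - h)

theorem natCard_isRoot_derivative_T (hd : 0 < d) :
    Nat.card {x : L // (derivative (T L d)).IsRoot x} = d - 1 := by
  rw [natCard_isRoot_of_separable (separable_derivative_T hd), natDegree_derivative, natDegree_T,
    Int.natAbs_natCast]

theorem natCard_isRoot_T_add_C (hd : 0 < d) {c : L} (h₁ : c ≠ 1) (h₂ : c ≠ -1) :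
    Nat.card {x : L // (T L d + C c).IsRoot x} = d := by
  rw [natCard_isRoot_of_separable (separable_T_add_C hd h₁ h₂), natDegree_add_C, natDegree_T,
    Int.natAbs_natCast]

end Chebyshev

section Hensel

open MvPolynomial IsLocalRing

variable {R : Type*} [CommRing R] {ι : Type*}

theorem eval_sub_eval_mem {I : Ideal R} (p : MvPolynomial ι R) {x y : ι → R}
    (h : ∀ i, x i - y i ∈ I) : eval x p - eval y p ∈ I := by
  rw [← Ideal.Quotient.eq, ← eval₂_id, ← eval₂_id, eval₂_comp_left, eval₂_comp_left]
  congr 1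
  funext i
  exact Ideal.Quotient.eq.mpr (h i)

theorem exists_limit_of_sub_mem_pow (I : Ideal R) [IsAdicComplete I R] {u : ℕ → ι → R}
    (hu : ∀ k i, u (k + 1) i - u k i ∈ I ^ k) :
    ∃ x : ι → R, ∀ k i, u k i - x i ∈ I ^ k := by
  have hcauchy : ∀ i {k l : ℕ}, k ≤ l → u k i ≡ u l i [SMOD (I ^ k • ⊤ : Submodule R R)] := by
    intro i k l hkl
    induction l, hkl using Nat.le_induction with
    | base => exact SModEq.refl _
    | succ l hkl ih =>
      refine ih.trans (SModEq.symm ?_)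
      rw [SModEq.sub_mem, smul_eq_mul, Ideal.mul_top]
      exact Ideal.pow_le_pow_right hkl (hu l i)
  choose x hx using fun i => IsPrecomplete.prec (inferInstance : IsPrecomplete I R) (hcauchy i)
  refine ⟨x, fun k i => ?_⟩
  have := hx i k
  rwa [SModEq.sub_mem, smul_eq_mul, Ideal.mul_top] at this

variable [Fintype ι]

theorem mulVec_mem {I : Ideal R} (M : Matrix ι ι R) {v : ι → R} (hv : ∀ i, v i ∈ I) (e : ι) :
    M.mulVec v e ∈ I :=
  Ideal.sum_mem _ fun i _ => Ideal.mul_mem_left _ _ (hv i)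

theorem sum_eval_pderiv_mul_X_mul (p : MvPolynomial ι R) (k : ι) (x h : ι → R) :
    ∑ i, eval x (pderiv i (p * X k)) * h i =
      (∑ i, eval x (pderiv i p) * h i) * x k + eval x p * h k := by
  classical
  simp only [Derivation.leibniz, pderiv_X, smul_eq_mul, map_add, map_mul, eval_X, add_mul,
    Finset.sum_add_distrib, Finset.sum_mul]
  rw [add_comm]
  congr 1
  · exact Finset.sum_congr rfl fun i _ => by ring
  · rw [Finset.sum_eq_single k (fun i _ hi => by simp [hi.symm]) (by simp)]
    simp

theorem eval_add_sub_mem_sq {I : Ideal R} (p : MvPolynomial ι R) (x : ι → R) {h : ι → R}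
    (hh : ∀ i, h i ∈ I) :
    eval (x + h) p - eval x p - ∑ i, eval x (pderiv i p) * h i ∈ I ^ 2 := by
  induction p using MvPolynomial.induction_on with
  | C r => simp
  | add p p' hp hp' =>
    convert add_mem hp hp' using 1
    simp only [map_add, add_mul, Finset.sum_add_distrib]
    ring
  | mul_X p k hp =>
    have hdiff : eval (x + h) p - eval x p ∈ I :=
      eval_sub_eval_mem p fun i => by simpa using hh i
    have hcross : (eval (x + h) p - eval x p) * h k ∈ I ^ 2 := by
      rw [pow_two]
      exact Ideal.mul_mem_mul hdiff (hh k)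
    convert add_mem (Ideal.mul_mem_right (x k) _ hp) hcross using 1
    rw [sum_eval_pderiv_mul_X_mul]
    simp only [map_mul, eval_X, Pi.add_apply]
    ring

/-- The Jacobian matrix of a square system of polynomials at a point. -/
noncomputable def jacobian (p : ι → MvPolynomial ι R) (x : ι → R) : Matrix ι ι R :=
  Matrix.of fun e i => eval x (pderiv i (p e))

theorem eval_add_sub_mulVec_mem_sq {I : Ideal R} (p : ι → MvPolynomial ι R) (x : ι → R)
    {h : ι → R} (hh : ∀ i, h i ∈ I) (e : ι) :
    eval (x + h) (p e) - eval x (p e) - (jacobian p x).mulVec h e ∈ I ^ 2 :=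
  eval_add_sub_mem_sq (p e) x hh

variable [DecidableEq ι]

theorem eq_of_isUnit_det_jacobian [IsLocalRing R] {p : ι → MvPolynomial ι R} {x y : ι → R}
    (hx : ∀ e, eval x (p e) = 0) (hy : ∀ e, eval y (p e) = 0)
    (hxy : ∀ i, y i - x i ∈ maximalIdeal R) (hJ : IsUnit (jacobian p x).det) : x = y := by
  set I : Ideal R := Ideal.span (Set.range (y - x)) with hI
  have hmem : ∀ i, (y - x) i ∈ I := fun i => Ideal.subset_span ⟨i, rfl⟩
  have hJmem : ∀ e, (jacobian p x).mulVec (y - x) e ∈ I ^ 2 := by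
    intro e
    have := eval_add_sub_mulVec_mem_sq p x hmem e
    rwa [add_sub_cancel, hx, hy, sub_zero, zero_sub, neg_mem_iff] at this
  have hmem_sq : I ≤ I ^ 2 := by
    rw [hI, Ideal.span_le]
    rintro _ ⟨i, rfl⟩
    have := mulVec_mem (jacobian p x)⁻¹ hJmem i
    rwa [Matrix.mulVec_mulVec, Matrix.nonsing_inv_mul _ hJ, Matrix.one_mulVec] at this
  have hle : I ≤ maximalIdeal R := by
    rw [hI, Ideal.span_le]
    rintro _ ⟨i, rfl⟩
    exact hxy i
  have hle_smul : I ≤ maximalIdeal R • I :=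
    hmem_sq.trans (by rw [pow_two, smul_eq_mul]; exact Ideal.mul_mono_left hle)
  have hbot : I = ⊥ := Submodule.eq_bot_of_le_smul_of_le_jacobson_bot _ I
    (Submodule.fg_span (Set.finite_range _)) hle_smul (maximalIdeal_le_jacobson _)
  funext i
  have := hmem i
  rw [hbot, Ideal.mem_bot, Pi.sub_apply, sub_eq_zero] at this
  exact this.symm

/-- The Newton iteration for a square system, with the inverse of the Jacobian matrix at the
starting point `x₀` used in every step. -/
noncomputable def newtonStep (p : ι → MvPolynomial ι R) (x₀ x : ι → R) : ι → R :=
  x + -((jacobian p x₀)⁻¹.mulVec fun e => eval x (p e))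

theorem newtonStep_sub_mem {I : Ideal R} {p : ι → MvPolynomial ι R} (x₀ : ι → R) {x : ι → R}
    (hx : ∀ e, eval x (p e) ∈ I) (i : ι) : newtonStep p x₀ x i - x i ∈ I := by
  simp only [newtonStep, Pi.add_apply, add_sub_cancel_left, Pi.neg_apply]
  exact neg_mem (mulVec_mem _ hx i)

theorem eval_newtonStep_mem {I : Ideal R} {p : ι → MvPolynomial ι R} {x₀ x : ι → R}
    (hJ : IsUnit (jacobian p x₀).det) (hx₀ : ∀ i, x i - x₀ i ∈ I) {k : ℕ}
    (hx : ∀ e, eval x (p e) ∈ I ^ (k + 1)) (e : ι) :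
    eval (newtonStep p x₀ x) (p e) ∈ I ^ (k + 2) := by
  set v : ι → R := -((jacobian p x₀)⁻¹.mulVec fun e => eval x (p e)) with hv
  have hvmem : ∀ i, v i ∈ I ^ (k + 1) := fun i => neg_mem (mulVec_mem _ hx i)
  have hsolve : (jacobian p x₀).mulVec v = -fun e => eval x (p e) := by
    rw [hv, Matrix.mulVec_neg, Matrix.mulVec_mulVec, Matrix.mul_nonsing_inv _ hJ,
      Matrix.one_mulVec]
  have hjac : (jacobian p x).mulVec v e - (jacobian p x₀).mulVec v e ∈ I ^ (k + 2) := by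
    simp only [Matrix.mulVec, dotProduct, ← Finset.sum_sub_distrib]
    refine Ideal.sum_mem _ fun i _ => ?_
    rw [← sub_mul, pow_succ']
    exact Ideal.mul_mem_mul (eval_sub_eval_mem _ hx₀) (hvmem i)
  have htaylor : eval (x + v) (p e) - eval x (p e) - (jacobian p x).mulVec v e ∈ I ^ (k + 2) := by
    refine (?_ : (I ^ (k + 1)) ^ 2 ≤ I ^ (k + 2)) (eval_add_sub_mulVec_mem_sq p x hvmem e)
    rw [← pow_mul]
    exact Ideal.pow_le_pow_right (by lia)
  convert add_mem htaylor hjac using 1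
  rw [hsolve, newtonStep, Pi.neg_apply]
  ring

theorem exists_zero_of_isUnit_det_jacobian (I : Ideal R) [IsAdicComplete I R]
    {p : ι → MvPolynomial ι R} {x₀ : ι → R} (hx₀ : ∀ e, eval x₀ (p e) ∈ I)
    (hJ : IsUnit (jacobian p x₀).det) :
    ∃ x : ι → R, (∀ e, eval x (p e) = 0) ∧ ∀ i, x i - x₀ i ∈ I := by
  set u : ℕ → ι → R := fun k => (newtonStep p x₀)^[k] x₀
  have hu_succ : ∀ k, u (k + 1) = newtonStep p x₀ (u k) := fun k =>
    Function.iterate_succ_apply' _ _ _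
  have hu : ∀ k, (∀ i, u k i - x₀ i ∈ I) ∧ ∀ e, eval (u k) (p e) ∈ I ^ (k + 1) := by
    intro k
    induction k with
    | zero => exact ⟨fun i => by simp [u], fun e => by simpa [u] using hx₀ e⟩
    | succ k ih =>
      rw [hu_succ]
      refine ⟨fun i => ?_, eval_newtonStep_mem hJ ih.1 ih.2⟩
      have := Ideal.pow_le_self (Nat.succ_ne_zero k) (newtonStep_sub_mem x₀ ih.2 i)
      simpa using add_mem this (ih.1 i)
  obtain ⟨x, hx⟩ := exists_limit_of_sub_mem_pow I (u := u) fun k i => by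
    rw [hu_succ]
    exact Ideal.pow_le_pow_right k.le_succ (newtonStep_sub_mem x₀ (hu k).2 i)
  refine ⟨x, fun e => ?_, fun i => ?_⟩
  · refine IsHausdorff.haus (inferInstance : IsHausdorff I R) _ fun k => ?_
    rw [SModEq.zero, smul_eq_mul, Ideal.mul_top]
    have := Ideal.pow_le_pow_right k.le_succ ((hu k).2 e)
    simpa using sub_mem this (eval_sub_eval_mem (p e) (hx k))
  · have := hx 1 i
    rw [pow_one] at this
    simpa using sub_mem ((hu 1).1 i) this

end Hensel

section DualNumbers

open MvPolynomial TrivSqZeroExt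

variable {R : Type*} [CommRing R]

theorem eval₂_inlHom_inl_add_inr {ι : Type*} [Fintype ι] (p : MvPolynomial ι R) (x v : ι → R) :
    eval₂ (inlHom R R) (fun i => inl (x i) + inr (v i)) p =
      inl (eval x p) + inr (∑ i, eval x (pderiv i p) * v i) := by
  induction p using MvPolynomial.induction_on with
  | C r => simp [inlHom]
  | add p p' hp hp' =>
    simp only [eval₂_add, hp, hp', map_add, add_mul, Finset.sum_add_distrib, inl_add,
      inr_add]
    ring
  | mul_X p k hp =>
    rw [eval₂_mul, hp, eval₂_X, sum_eval_pderiv_mul_X_mul]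
    ext <;> simp [mul_comm, add_comm]

end DualNumbers

section Nullstellensatz

open MvPolynomial

variable {k L : Type*} [Field k] [IsAlgClosed k] [Field L] {σ ι : Type*} [Finite σ]

theorem exists_pow_mem_span_of_forall_eval_eq_zero {p : ι → MvPolynomial σ k}
    {r : MvPolynomial σ k} (h : ∀ x, (∀ e, eval x (p e) = 0) → eval x r = 0) :
    ∃ N, r ^ N ∈ Ideal.span (Set.range p) := by
  change r ∈ (Ideal.span (Set.range p)).radical
  rw [← vanishingIdeal_zeroLocus_eq_radical (K := k), mem_vanishingIdeal_iff]
  intro x hx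
  rw [zeroLocus_span] at hx
  rw [aeval_eq_eval]
  exact h x fun e => by simpa only [aeval_eq_eval] using hx (p e) ⟨e, rfl⟩

theorem exists_map_eq_of_finite_zeros (φ : k →+* L) {p : ι → MvPolynomial σ k}
    (hfin : {x : σ → k | ∀ e, eval x (p e) = 0}.Finite) {y : σ → L}
    (hy : ∀ e, eval₂ φ y (p e) = 0) : ∃ x : σ → k, ∀ i, φ (x i) = y i := by
  suffices key : ∀ i, ∃ b : k, φ b = y i from Classical.skolem.mp key
  intro i
  set r : MvPolynomial σ k := ∏ z ∈ hfin.toFinset, (X i - C (z i)) with hr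
  obtain ⟨N, hN⟩ := exists_pow_mem_span_of_forall_eval_eq_zero (p := p) (r := r) fun x hx => by
    rw [hr, map_prod]
    exact Finset.prod_eq_zero (hfin.mem_toFinset.mpr hx) (by simp)
  have hspan : Ideal.span (Set.range p) ≤ RingHom.ker (eval₂Hom φ y) := by
    rw [Ideal.span_le]
    rintro _ ⟨e, rfl⟩
    exact hy e
  have hzero := hspan hN
  rw [RingHom.mem_ker, map_pow, pow_eq_zero_iff', hr, map_prod, Finset.prod_eq_zero_iff] at hzero
  obtain ⟨⟨z, _, hz⟩, _⟩ := hzero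
  rw [map_sub, coe_eval₂Hom, eval₂_X, eval₂_C, sub_eq_zero] at hz
  exact ⟨z i, hz.symm⟩

end Nullstellensatz

section ScaledReduction

variable {R M k : Type*} [CommRing R] [CommRing M] [CommRing k]

/-- `b` is the reduction under `r` of the element `u ^ D * y` of `R`, where `R` maps to `M` by `h`.
If `u` reduces to zero, then `y` is allowed a pole of order `D` along `u`, and `b` is its leading
coefficient. -/
def HasScaledReduction (h : R →+* M) (r : R →+* k) (u : R) (D : ℕ) (y : M) (b : k) : Prop :=
  ∃ w : R, h u ^ D * y = h w ∧ r w = b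

namespace HasScaledReduction

variable {h : R →+* M} {r : R →+* k} {u : R} {D D' : ℕ} {y y' : M} {b b' : k}

theorem eq_zero (hh : Function.Injective h) (hy : HasScaledReduction h r u D 0 b) : b = 0 := by
  obtain ⟨w, hw, rfl⟩ := hy
  rw [mul_zero, eq_comm, map_eq_zero_iff h hh] at hw
  rw [hw, map_zero]

theorem const (h : R →+* M) (r : R →+* k) (u e : R) : HasScaledReduction h r u 0 (h e) (r e) :=
  ⟨e, by rw [pow_zero, one_mul], rfl⟩

theorem add (hy : HasScaledReduction h r u D y b) (hy' : HasScaledReduction h r u D y' b') :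
    HasScaledReduction h r u D (y + y') (b + b') := by
  obtain ⟨w, hw, rfl⟩ := hy
  obtain ⟨w', hw', rfl⟩ := hy'
  exact ⟨w + w', by rw [mul_add, hw, hw', map_add], map_add r w w'⟩

theorem mul (hy : HasScaledReduction h r u D y b) (hy' : HasScaledReduction h r u D' y' b') :
    HasScaledReduction h r u (D + D') (y * y') (b * b') := by
  obtain ⟨w, hw, rfl⟩ := hy
  obtain ⟨w', hw', rfl⟩ := hy'
  exact ⟨w * w', by rw [map_mul, ← hw, ← hw']; ring, map_mul r w w'⟩

theorem const_mul (e : R) (hy : HasScaledReduction h r u D y b) :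
    HasScaledReduction h r u D (h e * y) (r e * b) := by
  simpa only [zero_add] using (const h r u e).mul hy

theorem pow (hy : HasScaledReduction h r u 1 y b) (i : ℕ) :
    HasScaledReduction h r u i (y ^ i) (b ^ i) := by
  induction i with
  | zero => simpa only [pow_zero, map_one] using const h r u 1
  | succ i ih => simpa only [pow_succ] using ih.mul hy

theorem mono (hy : HasScaledReduction h r u D y b) (hD : D ≤ D') :
    HasScaledReduction h r u D' y (r u ^ (D' - D) * b) := by
  obtain ⟨w, hw, rfl⟩ := hy
  refine ⟨u ^ (D' - D) * w, ?_, by rw [map_mul, map_pow]⟩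
  rw [map_mul, map_pow, ← hw, ← mul_assoc, pow_sub_mul_pow _ hD]

theorem sum {ι : Type*} {s : Finset ι} {y : ι → M} {b : ι → k}
    (hy : ∀ i ∈ s, HasScaledReduction h r u D (y i) (b i)) :
    HasScaledReduction h r u D (∑ i ∈ s, y i) (∑ i ∈ s, b i) := by
  choose! w hw hb using hy
  refine ⟨∑ i ∈ s, w i, ?_, ?_⟩
  · rw [Finset.mul_sum, map_sum, Finset.sum_congr rfl hw]
  · rw [map_sum, Finset.sum_congr rfl hb]

theorem prod {ι : Type*} {s : Finset ι} {D : ι → ℕ} {y : ι → M} {b : ι → k}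
    (hy : ∀ i ∈ s, HasScaledReduction h r u (D i) (y i) (b i)) :
    HasScaledReduction h r u (∑ i ∈ s, D i) (∏ i ∈ s, y i) (∏ i ∈ s, b i) := by
  choose! w hw hb using hy
  refine ⟨∏ i ∈ s, w i, ?_, ?_⟩
  · rw [← Finset.prod_pow_eq_pow_sum, ← Finset.prod_mul_distrib, map_prod,
      Finset.prod_congr rfl hw]
  · rw [map_prod, Finset.prod_congr rfl hb]

theorem polynomial_eval (hu : r u = 0) (hy : HasScaledReduction h r u 1 y b) {p : Polynomial R}
    (hp : p.natDegree ≤ D) :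
    HasScaledReduction h r u D ((p.map h).eval y) (r (p.coeff D) * b ^ D) := by
  have hlead : r (p.coeff D) * b ^ D = ∑ i ∈ Finset.range (D + 1),
      r u ^ (D - i) * (r (p.coeff i) * b ^ i) := by
    rw [Finset.sum_range_succ, Finset.sum_eq_zero fun i hi => ?_, zero_add, Nat.sub_self, pow_zero,
      one_mul]
    rw [hu, zero_pow (Nat.sub_ne_zero_of_lt (Finset.mem_range.mp hi)), zero_mul]
  rw [hlead, Polynomial.eval_eq_sum_range'
    (Nat.lt_succ_of_le (Polynomial.natDegree_map_le.trans hp))]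
  refine sum fun i hi => mono ?_ (Nat.lt_succ_iff.mp (Finset.mem_range.mp hi))
  rw [Polynomial.coeff_map]
  exact (hy.pow i).const_mul _

theorem exists_mvPolynomial_eval₂ {K ι : Type*} [CommSemiring K] (c : K →+* R)
    {y : ι → M} {b : ι → k} (hy : ∀ i, HasScaledReduction h r u 1 (y i) (b i))
    {p : MvPolynomial ι K} (hp : p.totalDegree ≤ D) :
    ∃ b', HasScaledReduction h r u D (MvPolynomial.eval₂ (h.comp c) y p) b' := by
  rw [MvPolynomial.eval₂_eq]
  refine ⟨_, sum fun α hα => mono ((prod fun i _ => (hy i).pow (α i)).const_mul _) ?_⟩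
  exact (MvPolynomial.le_totalDegree hα).trans hp

end HasScaledReduction

theorem totalDegree_pderiv_le {K ι : Type*} [CommSemiring K] (j : ι) (p : MvPolynomial ι K) :
    (MvPolynomial.pderiv j p).totalDegree ≤ p.totalDegree - 1 := by
  conv_lhs => rw [← MvPolynomial.support_sum_monomial_coeff p, map_sum]
  refine MvPolynomial.totalDegree_finsetSum_le fun α hα => ?_
  rw [MvPolynomial.pderiv_monomial]
  rcases Nat.eq_zero_or_pos (α j) with h0 | hpos
  · rw [h0, Nat.cast_zero, mul_zero, MvPolynomial.monomial_zero, MvPolynomial.totalDegree_zero]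
    exact Nat.zero_le _
  · have hdeg : (α - Finsupp.single j 1).degree + 1 = α.degree := by
      have hle : Finsupp.single j 1 ≤ α := by simpa using Nat.succ_le_of_lt hpos
      conv_rhs => rw [← tsub_add_cancel_of_le hle, map_add, Finsupp.degree_single]
    have hα' : α.degree ≤ p.totalDegree := MvPolynomial.le_totalDegree hα
    refine (MvPolynomial.totalDegree_monomial_le _ _).trans ?_
    change (α - Finsupp.single j 1).degree ≤ _
    lia

end ScaledReduction

section Valuation

theorem exists_eq_mul_coe_and_exists_eq_one {M ι : Type*} [Field M] [Finite ι]
    (V : ValuationSubring M) {v : ι → M} (hv : v ≠ 0) :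
    ∃ (r : M) (w : ι → V), r ≠ 0 ∧ (∀ i, v i = r * (w i : M)) ∧ ∃ i, w i = 1 := by
  obtain ⟨i₁, hi₁⟩ := Function.ne_iff.mp hv
  have : Nonempty ι := ⟨i₁⟩
  obtain ⟨i₀, hmax⟩ := Finite.exists_max fun i => V.valuation (v i)
  have hne : v i₀ ≠ 0 := by
    intro h
    have := hmax i₁
    rw [h, map_zero] at this
    exact hi₁ ((map_eq_zero _).mp (le_antisymm this zero_le))
  refine ⟨v i₀, fun i => ⟨v i / v i₀, ?_⟩, hne, fun i => ?_, i₀, Subtype.ext (div_self hne)⟩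
  · rw [← V.valuation_le_one_iff, map_div₀]
    exact div_le_one_of_le₀ (hmax i) zero_le
  · rw [mul_div_cancel₀ _ hne]

end Valuation

section FiberCounting

theorem finite_and_natCard_of_fiber {α β : Type*} [Finite β] (φ : α → β) {k : ℕ}
    (h : ∀ b, Finite {x // φ x = b} ∧ Nat.card {x // φ x = b} = k) :
    Finite α ∧ Nat.card α = Nat.card β * k := by
  have := fun b => (h b).1
  refine ⟨Finite.of_equiv _ (Equiv.sigmaFiberEquiv φ), ?_⟩
  have := Fintype.ofFinite β
  rw [← Nat.card_congr (Equiv.sigmaFiberEquiv φ), Nat.card_sigma,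
    Finset.sum_congr rfl fun b _ => (h b).2, Finset.sum_const, smul_eq_mul, Finset.card_univ,
    Nat.card_eq_fintype_card]

end FiberCounting

section InitialForms

variable {K B B' : Type*} [Field K] [CommRing B] [CommRing B'] {n m : ℕ} {S : Finset (Fin m)}

/-- The row of the Cauchy matrix `a` which belongs to a multiplier: row `0` for `λ₀`, and the row of
`f̃_i` for `λ_i`. -/
def cauchyRow : Option S → ℕ
  | none => 0
  | some i => i.val.val + 1

/-- The sign with which the row of a multiplier enters `g̃_j`. -/
def multiplierSign (σ : S → ℤˣ) : Option S → ℤˣ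
  | none => 1
  | some i => -σ i

/-- The matrix of the linear forms `λ₀ a_{0j} - ∑_{i ∈ S} λ_i σ_i a_{ij}` in the multipliers `λ`,
with which `g̃_j` is the `j`-th form times `T_d'(x_j)`. -/
noncomputable def multiplierMatrix (c : K →+* B) (σ : S → ℤˣ) : Matrix (Fin n) (Option S) B :=
  Matrix.of fun j o =>
    ((multiplierSign σ o : ℤ) : B) * c ((a n (cauchyRow o) (j.val + 1) : ℚ) : K)

/-- The matrix `(a_{ij})` with `i ∈ S` and `1 ≤ j ≤ n`. -/
noncomputable def constraintMatrix (c : K →+* B) (S : Finset (Fin m)) : Matrix S (Fin n) B :=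
  Matrix.of fun i j => c ((a n (i.val.val + 1) (j.val + 1) : ℚ) : K)

/-- The affine forms `a_{i0} + ∑_j a_{ij} y_j`, which at `y_j = T_d(x_j) + 1` take the values of
`f̃_i`. -/
noncomputable def constraintForm (c : K →+* B) (S : Finset (Fin m)) (y : Fin n → B) : S → B :=
  (fun i => c ((a n (i.val.val + 1) 0 : ℚ) : K)) + (constraintMatrix c S).mulVec y

theorem map_multiplierMatrix_mulVec (h : B →+* B') (c : K →+* B) (σ : S → ℤˣ) (l : Option S → B)
    (j : Fin n) :
    h ((multiplierMatrix c σ).mulVec l j) = (multiplierMatrix (h.comp c) σ).mulVec (h ∘ l) j := by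
  simp [multiplierMatrix, Matrix.mulVec, dotProduct]

end InitialForms

section Evaluation

variable {K B : Type*} [Field K] [CommRing B] {n m : ℕ} {S : Finset (Fin m)}

open MvPolynomial

theorem eval₂_deform {ι : Type*} (ρ : K[X] →+* B) (x : ι → B) (p p' : MvPolynomial ι K) :
    eval₂ ρ x (deform p p') =
      ρ Polynomial.X * eval₂ (ρ.comp Polynomial.C) x p +
        (1 - ρ Polynomial.X) * eval₂ (ρ.comp Polynomial.C) x p' := by
  simp [deform, eval₂_map]

theorem eval₂_lagrange (c : K →+* B) (p : MvPolynomial (Fin n) K) (h : S → MvPolynomial (Fin n) K)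
    (j : Fin n) (x : Fin n → B) (l : Option S → B) :
    eval₂ c (Sum.elim x l) (lagrange S p h j) =
      l none * eval₂ c x (pderiv j p) - ∑ i : S, l (some i) * eval₂ c x (pderiv j (h i)) := by
  simp only [lagrange, eval₂_sub, eval₂_mul, eval₂_X, eval₂_sum, eval₂_rename, Sum.elim_inr,
    Sum.elim_comp_inl]

theorem eval₂_aeval_X {ι : Type*} (c : K →+* B) (x : ι → B) (j : ι) (p : K[X]) :
    eval₂ c x (Polynomial.aeval (X j) p) = p.eval₂ c (x j) := by
  rw [← coe_eval₂Hom, Polynomial.aeval_def, Polynomial.hom_eval₂, algebraMap_eq, coe_eval₂Hom,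
    eval₂_X]
  congr 1
  ext r
  simp

theorem eval₂_cheb (c : K →+* B) (d : ℕ) (j : Fin n) (x : Fin n → B) :
    eval₂ c x (cheb K n d j) = (Polynomial.Chebyshev.T B d).eval (x j) := by
  rw [cheb, eval₂_aeval_X, ← Polynomial.Chebyshev.map_T c, Polynomial.eval_map]

theorem eval₂_pderiv_cheb (c : K →+* B) (d : ℕ) (j k : Fin n) (x : Fin n → B) :
    eval₂ c x (pderiv k (cheb K n d j)) =
      if j = k then (Polynomial.derivative (Polynomial.Chebyshev.T B d)).eval (x j) else 0 := by
  rw [cheb, Derivation.map_aeval, pderiv_X, smul_eq_mul, eval₂_mul, eval₂_aeval_X,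
    ← Polynomial.Chebyshev.map_T c, Polynomial.derivative_map, Polynomial.eval_map]
  rcases eq_or_ne j k with rfl | h <;> simp [*]

theorem eval₂_fTildeSigned (c : K →+* B) (d : ℕ) (σ : S → ℤˣ) (i : S) (x : Fin n → B) :
    eval₂ c x (fTildeSigned n d S σ i) =
      ((σ i : ℤ) : B) *
        constraintForm c S (fun j => (Polynomial.Chebyshev.T B d).eval (x j) + 1) i := by
  have hint : ∀ z : ℤ, eval₂ c x (z : MvPolynomial (Fin n) K) = (z : B) :=
    fun z => by rw [← coe_eval₂Hom, map_intCast]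
  simp only [fTildeSigned, fTilde, eval₂_mul, hint, eval₂_add, eval₂_sum, eval₂_C, eval₂_cheb,
    eval₂_one, constraintForm, constraintMatrix, Pi.add_apply, Matrix.mulVec, dotProduct,
    Matrix.of_apply]

theorem eval₂_pderiv_fTildeSigned (c : K →+* B) (d : ℕ) (σ : S → ℤˣ) (i : S) (j : Fin n)
    (x : Fin n → B) :
    eval₂ c x (pderiv j (fTildeSigned n d S σ i)) =
      ((σ i : ℤ) : B) * c ((a n (i.val.val + 1) (j.val + 1) : ℚ) : K) *
        (Polynomial.derivative (Polynomial.Chebyshev.T B d)).eval (x j) := by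
  rw [fTildeSigned, fTilde, ← map_intCast (C (R := K) (σ := Fin n)), pderiv_C_mul, eval₂_mul,
    eval₂_C, map_intCast]
  simp only [map_add, map_sum, pderiv_C, pderiv_C_mul, pderiv_one, eval₂_sum, eval₂_mul, eval₂_C,
    eval₂_pderiv_cheb, zero_add, add_zero, mul_ite, mul_zero, Finset.sum_ite_eq', Finset.mem_univ,
    if_true]
  ring

theorem eval₂_pderiv_gTilde (c : K →+* B) (d : ℕ) (j : Fin n) (x : Fin n → B) :
    eval₂ c x (pderiv j (gTilde K n d)) =
      c ((a n 0 (j.val + 1) : ℚ) : K) *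
        (Polynomial.derivative (Polynomial.Chebyshev.T B d)).eval (x j) := by
  simp only [gTilde, pderiv_mul, map_sum, pderiv_C, eval₂_mul, eval₂_sum, eval₂_C,
    eval₂_pderiv_cheb, zero_mul, zero_add, mul_ite, mul_zero, Finset.sum_ite_eq', Finset.mem_univ,
    if_true]

theorem eval₂_gTildeLagrange (c : K →+* B) (d : ℕ) (σ : S → ℤˣ) (j : Fin n) (x : Fin n → B)
    (l : Option S → B) :
    eval₂ c (Sum.elim x l) (gTildeLagrange d S σ j) =
      (multiplierMatrix c σ).mulVec l j *
        (Polynomial.derivative (Polynomial.Chebyshev.T B d)).eval (x j) := by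
  rw [gTildeLagrange, eval₂_lagrange, eval₂_pderiv_gTilde]
  simp only [eval₂_pderiv_fTildeSigned, multiplierMatrix, Matrix.mulVec, dotProduct,
    Matrix.of_apply, Fintype.sum_option, multiplierSign, cauchyRow, Units.val_neg, Int.cast_neg,
    Units.val_one, Int.cast_one, one_mul, add_mul, Finset.sum_mul, neg_mul, Finset.sum_neg_distrib]
  rw [sub_eq_add_neg]
  congr 1
  · ring
  · exact congrArg _ (Finset.sum_congr rfl fun i _ => by ring)

theorem eval₂_F (ρ : K[X] →+* B) (d : ℕ) (f : Fin m → MvPolynomial (Fin n) K) (σ : S → ℤˣ) (i : S)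
    (x : Fin n → B) :
    eval₂ ρ x (F d f S σ i) =
      ρ Polynomial.X * eval₂ (ρ.comp Polynomial.C) x (f i.val) +
        (1 - ρ Polynomial.X) * (((σ i : ℤ) : B) * constraintForm (ρ.comp Polynomial.C) S
          (fun j => (Polynomial.Chebyshev.T B d).eval (x j) + 1) i) := by
  rw [F, eval₂_deform, eval₂_fTildeSigned]

theorem eval₂_G (ρ : K[X] →+* B) (d : ℕ) (f : Fin m → MvPolynomial (Fin n) K)
    (g : MvPolynomial (Fin n) K) (σ : S → ℤˣ) (j : Fin n) (x : Fin n → B) (l : Option S → B) :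
    eval₂ ρ (Sum.elim x l) (G d f g S σ j) =
      ρ Polynomial.X * (l none * eval₂ (ρ.comp Polynomial.C) x (pderiv j g) -
        ∑ i : S, l (some i) * eval₂ (ρ.comp Polynomial.C) x (pderiv j (f i.val))) +
        (1 - ρ Polynomial.X) * ((multiplierMatrix (ρ.comp Polynomial.C) σ).mulVec l j *
          (Polynomial.derivative (Polynomial.Chebyshev.T B d)).eval (x j)) := by
  rw [G, eval₂_deform, eval₂_lagrange, eval₂_gTildeLagrange]

end Evaluation

section LinearSystems

variable {L ι κ : Type*} [Field L] [Fintype ι] [Fintype κ]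

theorem existsUnique_mulVec_eq {M : Matrix ι κ L} {R : Finset κ} (hR : R.card = Fintype.card ι)
    (hM : ∀ y, (∀ j ∉ R, y j = 0) → M.mulVec y = 0 → y = 0) (w : κ → L) (b : ι → L) :
    ∃! y, (∀ j ∉ R, y j = w j) ∧ M.mulVec y = b := by
  classical
  let Φ : (κ → L) →ₗ[L] ({j // j ∉ R} → L) × (ι → L) :=
    (LinearMap.funLeft L L Subtype.val).prod M.mulVecLin
  have hΦ : ∀ y, Φ y = (fun j => y j.val, M.mulVec y) := fun _ => rfl
  have hinj : Function.Injective Φ := by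
    rw [← LinearMap.ker_eq_bot, LinearMap.ker_eq_bot']
    intro y hy
    rw [hΦ, Prod.mk_eq_zero] at hy
    exact hM y (fun j hj => congrFun hy.1 ⟨j, hj⟩) hy.2
  have hrank : Module.finrank L (κ → L) = Module.finrank L (({j // j ∉ R} → L) × (ι → L)) := by
    rw [Module.finrank_prod, Module.finrank_fintype_fun_eq_card, Module.finrank_fintype_fun_eq_card,
      Module.finrank_fintype_fun_eq_card, Fintype.card_subtype_compl, Fintype.card_coe, ← hR,
      Nat.sub_add_cancel (Finset.card_le_univ R)]
  have hbij : Function.Bijective Φ :=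
    ⟨hinj, (LinearMap.injective_iff_surjective_of_finrank_eq_finrank hrank).mp hinj⟩
  refine (existsUnique_congr fun y => ?_).mp (hbij.existsUnique (fun j => w j.val, b))
  rw [hΦ, Prod.mk.injEq, funext_iff, Subtype.forall]

end LinearSystems

section CauchyForms

variable {K L : Type*} [Field K] [Field L] [CharZero L] {n m : ℕ} {S : Finset (Fin m)}

theorem cauchyRow_injective : Function.Injective (cauchyRow : Option S → ℕ) := by
  rintro (_ | i) (_ | k) h
  · rfl
  · exact absurd h (Nat.succ_ne_zero _).symm
  · exact absurd h (Nat.succ_ne_zero _)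
  · exact congrArg some (Subtype.ext (Fin.ext (Nat.succ_injective h)))

theorem eq_zero_of_constraintMatrix_mulVec_eq_zero (c : K →+* L) {T : Finset (Fin n)}
    (hT : T.card ≤ S.card) {y : Fin n → L} (hy : ∀ j ∉ T, y j = 0)
    (h : (constraintMatrix c S).mulVec y = 0) : y = 0 := by
  have hzero := eq_zero_of_forall_sum_a_mul_eq_zero (s := (Finset.univ : Finset S)) (T := T)
    (r := fun i => i.val.val + 1) (y := y)
    (fun i _ k _ hik => Subtype.ext (Fin.ext (Nat.succ_injective hik)))
    (by rwa [Finset.card_univ, Fintype.card_coe]) fun i _ => ?_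
  · exact funext fun j => if hj : j ∈ T then hzero j hj else hy j hj
  · rw [Finset.sum_subset (Finset.subset_univ T) fun j _ hj => by rw [hy j hj, mul_zero]]
    simpa only [constraintMatrix, Matrix.mulVec, dotProduct, Matrix.of_apply, map_ratCast,
      Pi.zero_apply] using congrFun h i

theorem eq_zero_of_multiplierMatrix_mulVec_eq_zero (c : K →+* L) (σ : S → ℤˣ)
    {R : Finset (Option S)} {T : Finset (Fin n)} (hR : R.card ≤ T.card) {l : Option S → L}
    (hl : ∀ o ∉ R, l o = 0) (h : ∀ j ∈ T, (multiplierMatrix c σ).mulVec l j = 0) : l = 0 := by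
  have hzero := eq_zero_of_forall_sum_mul_a_eq_zero (s := R) (T := T) (r := cauchyRow)
    (v := fun o => ((multiplierSign σ o : ℤ) : L) * l o) cauchyRow_injective.injOn hR fun j hj => ?_
  · funext o
    by_cases ho : o ∈ R
    · have hsign : ((multiplierSign σ o : ℤ) : L) ≠ 0 := Int.cast_ne_zero.mpr (Units.ne_zero _)
      exact (mul_eq_zero.mp (hzero o ho)).resolve_left hsign
    · exact hl o ho
  · rw [Finset.sum_subset (Finset.subset_univ R) fun o _ ho => by rw [hl o ho, mul_zero, mul_zero],
      ← h j hj]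
    simp only [multiplierMatrix, Matrix.mulVec, dotProduct, Matrix.of_apply, map_ratCast]
    exact Finset.sum_congr rfl fun o _ => by ring

open Classical in
theorem card_multiplierMatrix_mulVec_eq_zero_le (c : K →+* L) (σ : S → ℤˣ) {l : Option S → L}
    (hl : l ≠ 0) :
    (Finset.univ.filter fun j : Fin n => (multiplierMatrix c σ).mulVec l j = 0).card ≤ S.card := by
  by_contra! hlt
  refine hl (eq_zero_of_multiplierMatrix_mulVec_eq_zero c σ (R := Finset.univ)
    (T := Finset.univ.filter fun j : Fin n => (multiplierMatrix c σ).mulVec l j = 0) ?_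
    (fun o ho => absurd (Finset.mem_univ o) ho) fun j hj => (Finset.mem_filter.mp hj).2)
  rwa [Finset.card_univ, Fintype.card_option, Fintype.card_coe]

theorem eq_zero_of_none_eq_zero_of_multiplierMatrix_mulVec_eq_zero (c : K →+* L) (σ : S → ℤˣ)
    {T : Finset (Fin n)} (hT : S.card ≤ T.card) {l : Option S → L} (hl : l none = 0)
    (h : ∀ j ∈ T, (multiplierMatrix c σ).mulVec l j = 0) : l = 0 := by
  refine eq_zero_of_multiplierMatrix_mulVec_eq_zero c σ
    (R := Finset.univ.map Function.Embedding.some) ?_ (fun o ho => ?_) h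
  · rwa [Finset.card_map, Finset.card_univ, Fintype.card_coe]
  · rcases o with _ | i
    · exact hl
    · simp at ho

theorem sum_mul_constraintForm (c : K →+* L) (w : S → ℚ) (y : Fin n → L) :
    ∑ i, (w i : L) * constraintForm c S y i =
      ((∑ i : S, w i * a n (i.val.val + 1) 0 : ℚ) : L) +
        ∑ j : Fin n, ((∑ i : S, w i * a n (i.val.val + 1) (j.val + 1) : ℚ) : L) * y j := by
  simp only [constraintForm, constraintMatrix, Pi.add_apply, Matrix.mulVec, dotProduct,
    Matrix.of_apply, map_ratCast, mul_add, Finset.sum_add_distrib, Finset.mul_sum, Rat.cast_sum,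
    Rat.cast_mul, Finset.sum_mul]
  congr 1
  rw [Finset.sum_comm]
  simp only [mul_assoc]

open Classical in
theorem card_le_of_constraintForm_eq_zero (c : K →+* L) {y : Fin n → L}
    (hy : constraintForm c S y = 0) :
    S.card ≤ (Finset.univ.filter fun j => y j ≠ 0 ∧ y j ≠ 2).card := by
  set T := Finset.univ.filter fun j => y j ≠ 0 ∧ y j ≠ 2 with hT
  set J := Finset.univ.filter fun j => y j = 2 with hJ
  by_contra! hlt
  obtain ⟨w, hw⟩ := exists_weights_sum_mul_a_eq_nodalRatio hlt
  have hterm : ∀ j, (nodalRatio S T (j.val + 1 : ℕ) : L) * y j =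
      if j ∈ J then 2 * (nodalRatio S T (j.val + 1 : ℕ) : L) else 0 := by
    intro j
    by_cases hjT : j ∈ T
    · rw [nodalRatio_eq_zero hjT, Rat.cast_zero, zero_mul, mul_zero, ite_self]
    · by_cases hj2 : y j = 2
      · simp [hJ, hj2, mul_comm]
      · have hj0 : y j = 0 := by simpa [hT, hj2] using hjT
        simp [hJ, hj0]
  have hsum := sum_mul_constraintForm c w y
  simp only [hy, Pi.zero_apply, mul_zero, Finset.sum_const_zero] at hsum
  rw [hw 0 n.zero_le, Finset.sum_congr rfl fun j _ => by rw [hw (j.val + 1) j.isLt, hterm j],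
    Finset.sum_ite_mem, Finset.univ_inter, ← Finset.mul_sum] at hsum
  refine nodalRatio_zero_add_two_mul_sum_ne_zero (T := T)
    (Finset.card_pos.mp (Nat.zero_lt_of_lt hlt)) J ?_
  exact_mod_cast hsum.symm

theorem card_eq_and_ne_of_constraintForm_eq_zero (c : K →+* L) {T : Finset (Fin n)}
    (hT : T.card ≤ S.card) {y : Fin n → L} (hyT : ∀ j ∉ T, y j = 0 ∨ y j = 2)
    (hy : constraintForm c S y = 0) : T.card = S.card ∧ ∀ j ∈ T, y j ≠ 0 ∧ y j ≠ 2 := by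
  classical
  have hcard := card_le_of_constraintForm_eq_zero c hy
  have hsub : (Finset.univ.filter fun j => y j ≠ 0 ∧ y j ≠ 2) ⊆ T := fun j hj => by
    by_contra hjT
    exact not_or.mpr (Finset.mem_filter.mp hj).2 (hyT j hjT)
  refine ⟨hT.antisymm (hcard.trans (Finset.card_le_card hsub)), fun j hj => ?_⟩
  rw [← Finset.eq_of_subset_of_card_le hsub (hT.trans hcard)] at hj
  exact (Finset.mem_filter.mp hj).2

theorem existsUnique_constraintForm_eq_zero (c : K →+* L) {T : Finset (Fin n)}
    (hT : T.card = S.card) (w : Fin n → L) :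
    ∃! y, (∀ j ∉ T, y j = w j) ∧ constraintForm c S y = 0 := by
  simp only [constraintForm, add_eq_zero_iff_eq_neg']
  exact existsUnique_mulVec_eq (by rw [hT, Fintype.card_coe])
    (fun y => eq_zero_of_constraintMatrix_mulVec_eq_zero c hT.le) w _

theorem existsUnique_multiplier (c : K →+* L) (σ : S → ℤˣ) {T : Finset (Fin n)}
    (hT : T.card = S.card) :
    ∃! l : S → L, ∀ j ∈ T, (multiplierMatrix c σ).mulVec (dehom l) j = 0 := by
  obtain ⟨l, ⟨hl₁, hl⟩, huniq⟩ := existsUnique_mulVec_eq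
    (M := (multiplierMatrix c σ).submatrix (Subtype.val : T → Fin n) id)
    (R := Finset.univ.map Function.Embedding.some)
    (by rw [Finset.card_map, Finset.card_univ, Fintype.card_coe, Fintype.card_coe, hT])
    (fun l hl h => eq_zero_of_multiplierMatrix_mulVec_eq_zero c σ
      (by rw [Finset.card_map, Finset.card_univ, Fintype.card_coe, hT]) hl
      fun j hj => congrFun h ⟨j, hj⟩) (fun _ => 1) 0
  have hdehom : dehom (fun i => l (some i)) = l := by
    funext o
    rcases o with _ | i
    · exact (hl₁ none (by simp)).symm
    · rfl
  refine ⟨fun i => l (some i), fun j hj => ?_, fun l' hl' => funext fun i => ?_⟩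
  · rw [hdehom]
    exact congrFun hl ⟨j, hj⟩
  · refine congrFun (huniq (dehom l') ⟨fun o ho => ?_, funext fun j => hl' j j.2⟩) (some i)
    rcases o with _ | i
    · rfl
    · simp at ho

end CauchyForms

section System

open MvPolynomial

variable {K B B' : Type*} [Field K] [CommRing B] [CommRing B'] {n m : ℕ} {S : Finset (Fin m)}
  {ρ : K[X] →+* B} {d : ℕ} {f : Fin m → MvPolynomial (Fin n) K} {g : MvPolynomial (Fin n) K}
  {σ : S → ℤˣ} {x : Fin n → B} {l : Option S → B}

/-- The point `x` together with the vector `l` of multipliers is a zero of the deformed system. The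
points of `variety` are of this form, as are those of `affineZeros`, where `l` has the entry `1` at
`λ₀`. -/
def IsSystemZero (ρ : K[X] →+* B) (d : ℕ) (f : Fin m → MvPolynomial (Fin n) K)
    (g : MvPolynomial (Fin n) K) (σ : S → ℤˣ) (x : Fin n → B) (l : Option S → B) : Prop :=
  (∀ i, eval₂ ρ x (F d f S σ i) = 0) ∧ ∀ j, eval₂ ρ (Sum.elim x l) (G d f g S σ j) = 0

/-- The point `x` together with the vector `l` of multipliers is a zero of the initial system, that
is, of the deformed system at `t = 0`. -/
def IsInitialZero (c : K →+* B) (d : ℕ) (σ : S → ℤˣ) (x : Fin n → B) (l : Option S → B) : Prop :=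
  constraintForm c S (fun j => (Polynomial.Chebyshev.T B d).eval (x j) + 1) = 0 ∧
    ∀ j, (multiplierMatrix c σ).mulVec l j *
      (Polynomial.derivative (Polynomial.Chebyshev.T B d)).eval (x j) = 0

theorem forall_eval₂_fTildeSigned_eq_zero_iff {c : K →+* B} :
    (∀ i, eval₂ c x (fTildeSigned n d S σ i) = 0) ↔
      constraintForm c S (fun j => (Polynomial.Chebyshev.T B d).eval (x j) + 1) = 0 := by
  rw [funext_iff]
  refine forall_congr' fun i => ?_
  rw [eval₂_fTildeSigned, Pi.zero_apply]
  exact (((σ i).isUnit.map (Int.castRingHom B)).mul_right_eq_zero)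

theorem isSystemZero_iff_of_map_X_eq_zero (hρ : ρ Polynomial.X = 0) :
    IsSystemZero ρ d f g σ x l ↔ IsInitialZero (ρ.comp Polynomial.C) d σ x l := by
  simp only [IsSystemZero, IsInitialZero, F, G, eval₂_deform, hρ, zero_mul, zero_add, sub_zero,
    one_mul, forall_eval₂_fTildeSigned_eq_zero_iff, eval₂_gTildeLagrange]

theorem mem_initialZeros_iff {L : Type*} [Field L] [Algebra K L] {P : (Fin n → L) × (S → L)} :
    P ∈ initialZeros (K := K) L n d S σ ↔
      IsInitialZero (algebraMap K L) d σ P.1 (dehom P.2) := by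
  simp only [initialZeros, IsInitialZero, Set.mem_ofPred_eq, aeval_def,
    forall_eval₂_fTildeSigned_eq_zero_iff, eval₂_gTildeLagrange]

theorem IsSystemZero.map (hx : IsSystemZero ρ d f g σ x l) (h : B →+* B') :
    IsSystemZero (h.comp ρ) d f g σ (h ∘ x) (h ∘ l) := by
  simp only [IsSystemZero, ← Sum.comp_elim, ← eval₂_comp_left]
  exact ⟨fun i => by rw [hx.1 i, map_zero], fun j => by rw [hx.2 j, map_zero]⟩

theorem isSystemZero_map_iff {h : B →+* B'} (hh : Function.Injective h) :
    IsSystemZero (h.comp ρ) d f g σ (h ∘ x) (h ∘ l) ↔ IsSystemZero ρ d f g σ x l := by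
  simp only [IsSystemZero, ← Sum.comp_elim, ← eval₂_comp_left, map_eq_zero_iff h hh]

theorem IsSystemZero.smul (h : IsSystemZero ρ d f g σ x l) (r : B) :
    IsSystemZero ρ d f g σ x (r • l) := by
  refine ⟨h.1, fun j => ?_⟩
  have hG := congrArg (r * ·) (h.2 j)
  simp only [eval₂_G, mul_zero] at hG ⊢
  rw [← hG, Matrix.mulVec_smul]
  simp only [Pi.smul_apply, smul_eq_mul, mul_assoc, ← Finset.mul_sum]
  ring

theorem isSystemZero_smul_iff {r : B} (hr : IsUnit r) :
    IsSystemZero ρ d f g σ x (r • l) ↔ IsSystemZero ρ d f g σ x l := by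
  obtain ⟨u, rfl⟩ := hr
  refine ⟨fun h => ?_, fun h => h.smul _⟩
  have := h.smul (u⁻¹ : Bˣ)
  rwa [smul_smul, Units.inv_mul, one_smul] at this

/-- The coordinatewise image of a point under a ring homomorphism. -/
def mapPoint {ι κ : Type*} (h : B →+* B') (P : (ι → B) × (κ → B)) : (ι → B') × (κ → B') :=
  (h ∘ P.1, h ∘ P.2)

theorem mapPoint_injective {ι κ : Type*} {h : B →+* B'} (hh : Function.Injective h) :
    Function.Injective (mapPoint h : (ι → B) × (κ → B) → (ι → B') × (κ → B')) :=
  hh.comp_left.prodMap hh.comp_left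

theorem dehom_ne_zero [Nontrivial B] (l : S → B) : dehom l ≠ 0 := fun h =>
  one_ne_zero (congrFun h none)

theorem map_comp_dehom (h : B →+* B') (l : S → B) : h ∘ dehom l = dehom (h ∘ l) :=
  funext <| Option.rec (map_one h) fun _ => rfl

theorem mapPoint_mem_affineZeros (h : B →+* B') {P : (Fin n → B) × (S → B)}
    (hP : P ∈ affineZeros ρ d f g S σ) : mapPoint h P ∈ affineZeros (h.comp ρ) d f g S σ := by
  have hzero := IsSystemZero.map hP h
  rwa [map_comp_dehom] at hzero

theorem mapPoint_mem_affineZeros_iff {h : B →+* B'} (hh : Function.Injective h)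
    {P : (Fin n → B) × (S → B)} :
    mapPoint h P ∈ affineZeros (h.comp ρ) d f g S σ ↔ P ∈ affineZeros ρ d f g S σ := by
  refine Iff.trans ?_ (isSystemZero_map_iff hh)
  rw [map_comp_dehom]
  exact Iff.rfl

/-- The square system in the variables `x_j` and `λ_i`, `i ∈ S`, which consists of the `G_j`
dehomogenized with `λ₀ = 1` and of the `F_i`. -/
noncomputable def system (d : ℕ) (f : Fin m → MvPolynomial (Fin n) K) (g : MvPolynomial (Fin n) K)
    (σ : S → ℤˣ) : Fin n ⊕ S → MvPolynomial (Fin n ⊕ S) K[X] :=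
  Sum.elim
    (fun j => bind₁ (Sum.elim (X ∘ Sum.inl) (dehom (X ∘ Sum.inr))) (G d f g S σ j))
    (fun i => rename Sum.inl (F d f S σ i))

theorem forall_eval₂_system_eq_zero_iff {z : Fin n ⊕ S → B} :
    (∀ e, eval₂ ρ z (system d f g σ e) = 0) ↔
      IsSystemZero ρ d f g σ (z ∘ Sum.inl) (dehom (z ∘ Sum.inr)) := by
  rw [Sum.forall, and_comm]
  refine and_congr (forall_congr' fun i => ?_) (forall_congr' fun j => ?_)
  · rw [system, Sum.elim_inr, eval₂_rename]
  · rw [system, Sum.elim_inl, ← coe_eval₂Hom, eval₂Hom_bind₁, coe_eval₂Hom]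
    suffices (fun e => eval₂ ρ z (Sum.elim (X ∘ Sum.inl) (dehom (X ∘ Sum.inr)) e)) =
      Sum.elim (z ∘ Sum.inl) (dehom (z ∘ Sum.inr)) by rw [← this]; rfl
    funext e
    rcases e with k | _ | i <;> simp [dehom]

theorem mem_affineZeros_iff {z : Fin n ⊕ S → B} :
    (z ∘ Sum.inl, z ∘ Sum.inr) ∈ affineZeros ρ d f g S σ ↔
      ∀ e, eval z (MvPolynomial.map ρ (system d f g σ e)) = 0 := by
  simp only [eval_map]
  exact forall_eval₂_system_eq_zero_iff.symm

end System

section InitialSystem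

variable {K L : Type*} [Field K] [Field L] [CharZero L] {n m : ℕ} {S : Finset (Fin m)}
  {c : K →+* L} {d : ℕ} {σ : S → ℤˣ} {x : Fin n → L} {l : Option S → L}

theorem eval_T_add_one_of_isRoot_derivative (hd : 0 < d) {z : L}
    (hz : (Polynomial.derivative (Polynomial.Chebyshev.T L d)).eval z = 0) :
    (Polynomial.Chebyshev.T L d).eval z + 1 = 0 ∨ (Polynomial.Chebyshev.T L d).eval z + 1 = 2 := by
  rcases eval_T_of_isRoot_derivative hd hz with h | h
  · exact Or.inr (by rw [h, one_add_one_eq_two])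
  · exact Or.inl (by rw [h, neg_add_cancel])

open Classical in
/-- The coordinates of `x` at which `T_d` is not critical. At an initial zero exactly `s` of the
linear forms `λ₀ a_{0j} - ∑ λ_i σ_i a_{ij}` vanish, and these are the coordinates `j` they
belong to. -/
noncomputable def regularCoords (d : ℕ) (x : Fin n → L) : Finset (Fin n) :=
  Finset.univ.filter fun j => (Polynomial.derivative (Polynomial.Chebyshev.T L d)).eval (x j) ≠ 0

omit [CharZero L] in
theorem mem_regularCoords {j : Fin n} :
    j ∈ regularCoords d x ↔
      (Polynomial.derivative (Polynomial.Chebyshev.T L d)).eval (x j) ≠ 0 := by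
  simp [regularCoords]

theorem regularCoords_eq_and_card_eq (hd : 0 < d) {T : Finset (Fin n)} (hT : T.card ≤ S.card)
    (hx : ∀ j ∉ T, (Polynomial.derivative (Polynomial.Chebyshev.T L d)).eval (x j) = 0)
    (h : constraintForm c S (fun j => (Polynomial.Chebyshev.T L d).eval (x j) + 1) = 0) :
    regularCoords d x = T ∧ T.card = S.card := by
  obtain ⟨hcard, hne⟩ := card_eq_and_ne_of_constraintForm_eq_zero c hT
    (fun j hj => eval_T_add_one_of_isRoot_derivative hd (hx j hj)) h
  refine ⟨Finset.ext fun j => ⟨fun hj => ?_, fun hj => ?_⟩, hcard⟩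
  · by_contra hjT
    exact mem_regularCoords.mp hj (hx j hjT)
  · refine mem_regularCoords.mpr fun h0 => ?_
    exact not_or.mpr (hne j hj) (eval_T_add_one_of_isRoot_derivative hd h0)

namespace IsInitialZero

omit [CharZero L] in
theorem mulVec_eq_zero (h : IsInitialZero c d σ x l) {j : Fin n} (hj : j ∈ regularCoords d x) :
    (multiplierMatrix c σ).mulVec l j = 0 :=
  (mul_eq_zero.mp (h.2 j)).resolve_right (mem_regularCoords.mp hj)

theorem mem_regularCoords_iff_and_card_eq (h : IsInitialZero c d σ x l) (hd : 0 < d) (hl : l ≠ 0) :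
    (∀ j, j ∈ regularCoords d x ↔ (multiplierMatrix c σ).mulVec l j = 0) ∧
      (regularCoords d x).card = S.card := by
  classical
  obtain ⟨hT, hcard⟩ := regularCoords_eq_and_card_eq hd
    (card_multiplierMatrix_mulVec_eq_zero_le c σ hl) (fun j hj => (mul_eq_zero.mp
      (h.2 j)).resolve_left fun h0 => hj (Finset.mem_filter.mpr ⟨Finset.mem_univ j, h0⟩)) h.1
  exact ⟨fun j => by rw [hT, Finset.mem_filter, and_iff_right (Finset.mem_univ j)], hT ▸ hcard⟩

theorem none_ne_zero (h : IsInitialZero c d σ x l) (hd : 0 < d) (hl : l ≠ 0) : l none ≠ 0 :=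
  fun h0 => hl (eq_zero_of_none_eq_zero_of_multiplierMatrix_mulVec_eq_zero c σ
    (h.mem_regularCoords_iff_and_card_eq hd hl).2.ge h0 fun _ => h.mulVec_eq_zero)

end IsInitialZero

theorem isInitialZero_dehom_inj {l l' : S → L} (hd : 0 < d)
    (h : IsInitialZero c d σ x (dehom l)) (h' : IsInitialZero c d σ x (dehom l')) : l = l' :=
  (existsUnique_multiplier c σ
    (h.mem_regularCoords_iff_and_card_eq hd (dehom_ne_zero l)).2).unique
    (fun _ => h.mulVec_eq_zero) fun _ => h'.mulVec_eq_zero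

end InitialSystem

section Tangent

open TrivSqZeroExt

variable {K L : Type*} [Field K] [Field L] {n m : ℕ} {S : Finset (Fin m)}
  {c : K →+* L} {d : ℕ} {σ : S → ℤˣ} {x v : Fin n → L} {l u : Option S → L}

theorem eval_map_inlHom_inl_add_inr (p : L[X]) (z w : L) :
    (p.map (inlHom L L)).eval (inl z + inr w : DualNumber L) =
      inl (p.eval z) + inr (p.derivative.eval z * w) := by
  have heval : ∀ p : L[X], (p.map (inlHom L L)).eval (inl z) = inl (p.eval z) := fun p => by
    rw [Polynomial.eval_map]
    exact Polynomial.eval₂_at_apply (inlHom L L) z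
  rw [Polynomial.eval_add_of_sq_eq_zero _ _ _ (by rw [pow_two, inr_mul_inr]),
    Polynomial.derivative_map, heval, heval, inl_mul_inr, smul_eq_mul]

theorem constraintMatrix_mulVec_eq_zero_of_dualNumber (h : IsInitialZero ((inlHom L L).comp c) d σ
      (fun j => (inl (x j) + inr (v j) : DualNumber L)) fun o => inl (l o) + inr (u o)) :
    (constraintMatrix c S).mulVec
      (fun j => (Polynomial.derivative (Polynomial.Chebyshev.T L d)).eval (x j) * v j) = 0 := by
  funext i
  have hi := congrArg snd (congrFun h.1 i)
  rw [← Polynomial.Chebyshev.map_T (inlHom L L)] at hi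
  simp only [eval_map_inlHom_inl_add_inr] at hi
  simpa [constraintForm, constraintMatrix, Matrix.mulVec, dotProduct, snd_sum] using hi

theorem multiplierMatrix_mulVec_eq_zero_of_dualNumber (h : IsInitialZero ((inlHom L L).comp c) d σ
      (fun j => (inl (x j) + inr (v j) : DualNumber L)) fun o => inl (l o) + inr (u o))
    (j : Fin n) :
    (multiplierMatrix c σ).mulVec l j * ((Polynomial.derivative (Polynomial.derivative
        (Polynomial.Chebyshev.T L d))).eval (x j) * v j) +
      (multiplierMatrix c σ).mulVec u j *
        (Polynomial.derivative (Polynomial.Chebyshev.T L d)).eval (x j) = 0 := by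
  have hj := congrArg snd (h.2 j)
  rw [← Polynomial.Chebyshev.map_T (inlHom L L), Polynomial.derivative_map,
    eval_map_inlHom_inl_add_inr] at hj
  have hmul : (multiplierMatrix ((inlHom L L).comp c) σ).mulVec
      (fun o => (inl (l o) + inr (u o) : DualNumber L)) j =
        inl ((multiplierMatrix c σ).mulVec l j) + inr ((multiplierMatrix c σ).mulVec u j) := by
    ext <;> simp [multiplierMatrix, Matrix.mulVec, dotProduct, fst_sum, snd_sum]
  rw [hmul] at hj
  simpa using hj

theorem eval₂_inlHom_comp_inl_add_inr {A ι : Type*} [CommRing A] [Fintype ι] (ρ : A →+* L)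
    (p : ι → MvPolynomial ι A) (z v : ι → L) (e : ι) :
    MvPolynomial.eval₂ ((inlHom L L).comp ρ) (fun i => inl (z i) + inr (v i)) (p e) =
      inl (MvPolynomial.eval₂ ρ z (p e)) +
        inr ((jacobian (fun e => MvPolynomial.map ρ (p e)) z).mulVec v e) := by
  rw [← MvPolynomial.eval₂_map, eval₂_inlHom_inl_add_inr, MvPolynomial.eval_map]
  rfl

variable [CharZero L]

theorem IsInitialZero.tangent_eq_zero (h : IsInitialZero c d σ x l) (hd : 0 < d) (hl : l ≠ 0)
    (hu : u none = 0)
    (hv : IsInitialZero ((inlHom L L).comp c) d σ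
      (fun j => (inl (x j) + inr (v j) : DualNumber L)) fun o => inl (l o) + inr (u o)) :
    v = 0 ∧ u = 0 := by
  obtain ⟨hreg, hcard⟩ := h.mem_regularCoords_iff_and_card_eq hd hl
  have hu_form : ∀ j ∈ regularCoords d x, (multiplierMatrix c σ).mulVec u j = 0 := fun j hj => by
    have := multiplierMatrix_mulVec_eq_zero_of_dualNumber hv j
    rw [(hreg j).mp hj, zero_mul, zero_add] at this
    exact (mul_eq_zero.mp this).resolve_right (mem_regularCoords.mp hj)
  have hv_crit : ∀ j ∉ regularCoords d x, v j = 0 := fun j hj => by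
    have hcrit : (Polynomial.derivative (Polynomial.Chebyshev.T L d)).eval (x j) = 0 := by
      rwa [mem_regularCoords, not_not] at hj
    have := multiplierMatrix_mulVec_eq_zero_of_dualNumber hv j
    rw [hcrit, mul_zero, add_zero] at this
    exact (mul_eq_zero.mp ((mul_eq_zero.mp this).resolve_left (mt (hreg j).mpr hj))).resolve_left
      (eval_derivative_derivative_T_ne_zero hd hcrit)
  have hv_reg := eq_zero_of_constraintMatrix_mulVec_eq_zero c hcard.le
    (fun j hj => by rw [hv_crit j hj, mul_zero]) (constraintMatrix_mulVec_eq_zero_of_dualNumber hv)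
  refine ⟨funext fun j => ?_, eq_zero_of_none_eq_zero_of_multiplierMatrix_mulVec_eq_zero c σ
    hcard.ge hu hu_form⟩
  by_cases hj : j ∈ regularCoords d x
  · exact (mul_eq_zero.mp (congrFun hv_reg j)).resolve_left (mem_regularCoords.mp hj)
  · exact hv_crit j hj

theorem det_jacobian_system_ne_zero {ρ : K[X] →+* L} (hρ : ρ Polynomial.X = 0) (hd : 0 < d)
    {f : Fin m → MvPolynomial (Fin n) K} {g : MvPolynomial (Fin n) K} {z : Fin n ⊕ S → L}
    (hz : ∀ e, MvPolynomial.eval₂ ρ z (system d f g σ e) = 0) :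
    (jacobian (fun e => MvPolynomial.map ρ (system d f g σ e)) z).det ≠ 0 := by
  intro hdet
  obtain ⟨v, hv0, hv⟩ := Matrix.exists_mulVec_eq_zero_iff.mpr hdet
  have htangent : ∀ e, MvPolynomial.eval₂ ((inlHom L L).comp ρ)
      (fun i => (inl (z i) + inr (v i) : DualNumber L)) (system d f g σ e) = 0 := fun e => by
    rw [eval₂_inlHom_comp_inl_add_inr, hz, hv, Pi.zero_apply, inl_zero, inr_zero, add_zero]
  rw [forall_eval₂_system_eq_zero_iff, isSystemZero_iff_of_map_X_eq_zero hρ] at hz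
  rw [forall_eval₂_system_eq_zero_iff, isSystemZero_iff_of_map_X_eq_zero
    (by rw [RingHom.comp_apply, hρ, map_zero])] at htangent
  have hdehom : dehom ((fun i => (inl (z i) + inr (v i) : DualNumber L)) ∘ Sum.inr) =
      fun o => inl (dehom (z ∘ Sum.inr) o) +
        inr ((Option.rec 0 (v ∘ Sum.inr) : Option S → L) o) := by
    funext o
    rcases o with _ | i <;> simp [dehom]
  rw [hdehom] at htangent
  obtain ⟨hx, hl⟩ := hz.tangent_eq_zero hd (dehom_ne_zero _) rfl htangent
  exact hv0 (funext (Sum.rec (congrFun hx) fun i => congrFun hl (some i)))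

end Tangent

section Counting

variable {K L : Type*} [Field K] [Field L] [CharZero L] {n m : ℕ} {S : Finset (Fin m)}
  {c : K →+* L} {d : ℕ} {T : Finset (Fin n)}

/-- The points of the `x`-space at which the `f̃_i` vanish and `T_d` is critical in the coordinates
outside `T`. -/
def criticalPoints (c : K →+* L) (S : Finset (Fin m)) (d : ℕ) (T : Finset (Fin n)) :
    Set (Fin n → L) :=
  {x | (∀ j ∉ T, (Polynomial.derivative (Polynomial.Chebyshev.T L d)).eval (x j) = 0) ∧
    constraintForm c S (fun j => (Polynomial.Chebyshev.T L d).eval (x j) + 1) = 0}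

/-- The critical coordinates of a point of `criticalPoints`. -/
def criticalPart (x : criticalPoints c S d T) :
    {j // j ∉ T} → {z : L // (Polynomial.derivative (Polynomial.Chebyshev.T L d)).IsRoot z} :=
  fun j => ⟨x.val j, x.property.1 j j.property⟩

theorem exists_forall_mem_criticalPoints_iff (hd : 0 < d) (hT : T.card = S.card)
    (u : {j // j ∉ T} → {z : L // (Polynomial.derivative (Polynomial.Chebyshev.T L d)).IsRoot z}) :
    ∃ y : Fin n → L, (∀ j ∈ T, y j ≠ 0 ∧ y j ≠ 2) ∧ ∀ x : Fin n → L, (∀ j, x j.val = u j) →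
      (x ∈ criticalPoints c S d T ↔
        ∀ j ∈ T, (Polynomial.Chebyshev.T L d + Polynomial.C (1 - y j)).IsRoot (x j)) := by
  classical
  obtain ⟨y, ⟨hyu, hy⟩, huniq⟩ := existsUnique_constraintForm_eq_zero c hT fun j =>
    if h : j ∉ T then (Polynomial.Chebyshev.T L d).eval (u ⟨j, h⟩ : L) + 1 else 0
  replace hyu : ∀ j (hj : j ∉ T), y j = (Polynomial.Chebyshev.T L d).eval (u ⟨j, hj⟩ : L) + 1 :=
    fun j hj => by rw [hyu j hj, dif_pos hj]
  have hne := (card_eq_and_ne_of_constraintForm_eq_zero c hT.le (fun j hj => by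
    rw [hyu j hj]
    exact eval_T_add_one_of_isRoot_derivative hd (u ⟨j, hj⟩).property) hy).2
  refine ⟨y, hne, fun x hx => ?_⟩
  have hroot : ∀ j, (Polynomial.Chebyshev.T L d + Polynomial.C (1 - y j)).IsRoot (x j) ↔
      (Polynomial.Chebyshev.T L d).eval (x j) + 1 = y j := fun j => by
    rw [Polynomial.IsRoot, Polynomial.eval_add, Polynomial.eval_C, ← add_sub_assoc, sub_eq_zero]
  have hxu : ∀ j (hj : j ∉ T), x j = u ⟨j, hj⟩ := fun j hj => hx ⟨j, hj⟩
  refine ⟨fun h j _ => (hroot j).mpr (congrFun (huniq _ ⟨fun j hj => ?_, h.2⟩) j),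
    fun h => ⟨?_, ?_⟩⟩
  · rw [dif_pos hj, hxu j hj]
  · intro j hj
    rw [hxu j hj]
    exact (u ⟨j, hj⟩).property
  · convert hy with j
    by_cases hj : j ∈ T
    · exact (hroot j).mp (h j hj)
    · rw [hxu j hj, hyu j hj]

omit [CharZero L] in
theorem nonempty_criticalPart_fiber_equiv
    {u : {j // j ∉ T} → {z : L // (Polynomial.derivative (Polynomial.Chebyshev.T L d)).IsRoot z}}
    {R : T → Set L} (hR : ∀ x : Fin n → L, (∀ j, x j.val = u j) →
      (x ∈ criticalPoints c S d T ↔ ∀ j : T, x j ∈ R j)) :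
    Nonempty ({x : criticalPoints c S d T // criticalPart x = u} ≃ ∀ j, R j) := by
  classical
  have hu : ∀ x : criticalPoints c S d T, criticalPart x = u ↔ ∀ j, x.val j.val = u j := fun x =>
    funext_iff.trans (forall_congr' fun j => Subtype.ext_iff)
  obtain ⟨glue, hglue_mem, hglue_notMem⟩ : ∃ glue : (∀ j, R j) → Fin n → L,
      (∀ z (j : T), glue z j = z j) ∧ ∀ z (j : {j // j ∉ T}), glue z j = u j :=
    ⟨fun z j => if h : j ∈ T then z ⟨j, h⟩ else u ⟨j, h⟩, fun _ j => dif_pos j.property,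
      fun _ j => dif_neg j.property⟩
  refine ⟨⟨fun x j => ⟨x.val.val j, (hR _ ((hu _).mp x.property)).mp x.val.property j⟩,
    fun z => ⟨⟨glue z, (hR _ (hglue_notMem z)).mpr fun j => ?_⟩, (hu _).mpr (hglue_notMem z)⟩,
    fun x => Subtype.ext (Subtype.ext (funext fun j => ?_)),
    fun z => funext fun j => Subtype.ext (hglue_mem z j)⟩⟩
  · rw [hglue_mem]
    exact (z j).property
  · dsimp only
    by_cases hj : j ∈ T
    · exact hglue_mem _ ⟨j, hj⟩
    · exact (hglue_notMem _ ⟨j, hj⟩).trans ((hu _).mp x.property ⟨j, hj⟩).symm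

theorem nonempty_regularCoords_fiber_equiv (hd : 0 < d) (hT : T.card = S.card) (σ : S → ℤˣ) :
    Nonempty ({P : {P : (Fin n → L) × (S → L) // IsInitialZero c d σ P.1 (dehom P.2)} //
      regularCoords d P.val.1 = T} ≃ criticalPoints c S d T) := by
  refine ⟨Equiv.ofBijective (fun P => ⟨P.val.val.1, fun j hj => ?_, P.val.property.1⟩) ⟨?_, ?_⟩⟩
  · rwa [← P.property, mem_regularCoords, not_not] at hj
  · intro P Q hPQ
    have hx : P.val.val.1 = Q.val.val.1 := congrArg Subtype.val hPQ
    have hQ := Q.val.property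
    rw [← hx] at hQ
    exact Subtype.ext (Subtype.ext
      (Prod.ext hx (isInitialZero_dehom_inj hd P.val.property hQ)))
  · rintro ⟨x, hx, hconstraint⟩
    obtain ⟨l, hl, -⟩ := existsUnique_multiplier c σ hT
    refine ⟨⟨⟨(x, l), hconstraint, fun j => ?_⟩,
      (regularCoords_eq_and_card_eq hd hT.le hx hconstraint).1⟩, rfl⟩
    by_cases hj : j ∈ T
    · rw [hl j hj, zero_mul]
    · rw [hx j hj, mul_zero]

variable [IsAlgClosed L]

theorem finite_and_natCard_criticalPoints (hd : 0 < d) (hT : T.card = S.card) :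
    Finite (criticalPoints c S d T) ∧
      Nat.card (criticalPoints c S d T) = (d - 1) ^ (n - S.card) * d ^ S.card := by
  have hfiber : ∀ u, Finite {x : criticalPoints c S d T // criticalPart x = u} ∧
      Nat.card {x : criticalPoints c S d T // criticalPart x = u} = d ^ S.card := fun u => by
    obtain ⟨y, hy, hmem⟩ := exists_forall_mem_criticalPoints_iff (c := c) hd hT u
    have h₁ : ∀ j : T, 1 - y j ≠ 1 := fun j h =>
      (hy j j.property).1 (by linear_combination -h)
    have h₂ : ∀ j : T, 1 - y j ≠ -1 := fun j h => (hy j j.property).2 (by linear_combination -h)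
    obtain ⟨e⟩ := nonempty_criticalPart_fiber_equiv (R := fun j : T =>
      {z | (Polynomial.Chebyshev.T L d + Polynomial.C (1 - y j)).IsRoot z}) fun x hx => by
        rw [hmem x hx, Subtype.forall]; rfl
    have : ∀ j : T,
        Finite {z | (Polynomial.Chebyshev.T L d + Polynomial.C (1 - y j)).IsRoot z} := fun j =>
      Polynomial.finite_setOfPred_isRoot (separable_T_add_C hd (h₁ j) (h₂ j)).ne_zero
    refine ⟨Finite.of_equiv _ e.symm, ((Nat.card_congr e).trans Nat.card_pi).trans ?_⟩
    refine (Finset.prod_congr rfl fun j _ => natCard_isRoot_T_add_C hd (h₁ j) (h₂ j)).trans ?_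
    rw [Finset.prod_const, Finset.card_univ, Fintype.card_coe, hT]
  have : Finite {z : L // (Polynomial.derivative (Polynomial.Chebyshev.T L d)).IsRoot z} :=
    Polynomial.finite_setOfPred_isRoot (separable_derivative_T hd).ne_zero
  obtain ⟨hfin, hcard⟩ := finite_and_natCard_of_fiber criticalPart hfiber
  refine ⟨hfin, hcard.trans ?_⟩
  rw [Nat.card_fun, natCard_isRoot_derivative_T hd, Nat.card_eq_fintype_card,
    Fintype.card_subtype_compl, Fintype.card_coe, Fintype.card_fin, hT]

theorem finite_and_natCard_isInitialZero (hd : 0 < d) (σ : S → ℤˣ) :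
    Finite {P : (Fin n → L) × (S → L) // IsInitialZero c d σ P.1 (dehom P.2)} ∧
      Nat.card {P : (Fin n → L) × (S → L) // IsInitialZero c d σ P.1 (dehom P.2)} =
        bezoutNumber n d S.card := by
  have hreg (P : {P : (Fin n → L) × (S → L) // IsInitialZero c d σ P.1 (dehom P.2)}) :=
    P.property.mem_regularCoords_iff_and_card_eq hd (dehom_ne_zero P.val.2)
  let φ (P : {P : (Fin n → L) × (S → L) // IsInitialZero c d σ P.1 (dehom P.2)}) :
    {T : Finset (Fin n) // T.card = S.card} := ⟨regularCoords d P.val.1, (hreg P).2⟩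
  have hfiber : ∀ T, Finite {P // φ P = T} ∧
      Nat.card {P // φ P = T} = (d - 1) ^ (n - S.card) * d ^ S.card := fun T => by
    obtain ⟨e⟩ := nonempty_regularCoords_fiber_equiv (c := c) hd T.property σ
    have e' := Equiv.subtypeEquivRight (p := (φ · = T))
      (q := fun P => regularCoords d P.val.1 = T.val) fun _ => Subtype.ext_iff
    obtain ⟨hfin, hcard⟩ := finite_and_natCard_criticalPoints (c := c) hd T.property
    exact ⟨Finite.of_equiv _ (e'.trans e).symm, (Nat.card_congr (e'.trans e)).trans hcard⟩
  obtain ⟨hfin, hcard⟩ := finite_and_natCard_of_fiber φ hfiber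
  refine ⟨hfin, hcard.trans ?_⟩
  rw [Nat.card_eq_fintype_card, Fintype.card_finset_len, Fintype.card_fin, bezoutNumber, mul_assoc,
    mul_comm (d ^ _)]

end Counting

section Infinity

variable {R M k : Type*} [CommRing R] [CommRing M] [Field k] {h : R →+* M} {r : R →+* k} {u : R}

theorem HasScaledReduction.eval_T {y : M} {b : k} (hy : HasScaledReduction h r u 1 y b)
    (hu : r u = 0) (d : ℕ) :
    HasScaledReduction h r u d ((Polynomial.Chebyshev.T M d).eval y) (2 ^ (d - 1) * b ^ d) := by
  have hT := hy.polynomial_eval hu (natDegree_T_le R d)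
  rwa [Polynomial.Chebyshev.map_T, coeff_T_self, map_pow, map_ofNat] at hT

theorem HasScaledReduction.eval_derivative_T {y : M} {b : k} {d : ℕ}
    (hy : HasScaledReduction h r u 1 y b) (hu : r u = 0) (hd : 0 < d) :
    HasScaledReduction h r u (d - 1) ((Polynomial.derivative (Polynomial.Chebyshev.T M d)).eval y)
      (2 ^ (d - 1) * d * b ^ (d - 1)) := by
  have hT := hy.polynomial_eval hu ((Polynomial.natDegree_derivative_le _).trans
    (Nat.sub_le_sub_right (natDegree_T_le R d) 1))
  rwa [← Polynomial.derivative_map, Polynomial.Chebyshev.map_T, Polynomial.coeff_derivative,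
    Nat.sub_add_cancel hd, coeff_T_self, Nat.cast_sub hd, Nat.cast_one, sub_add_cancel, map_mul,
    map_pow, map_ofNat, map_natCast] at hT

variable {K : Type*} [Field K] {n m d : ℕ} {S : Finset (Fin m)} {σ : S → ℤˣ}
  {f : Fin m → MvPolynomial (Fin n) K} {g : MvPolynomial (Fin n) K} {ρ : K[X] →+* R}
  {x : Fin n → M} {b : Fin n → k}

theorem HasScaledReduction.constraintForm (c : K →+* R) (hu : r u = 0) (hd : 0 < d)
    (hx : ∀ j, HasScaledReduction h r u 1 (x j) (b j)) (i : S) :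
    HasScaledReduction h r u d
      (constraintForm (h.comp c) S (fun j => (Polynomial.Chebyshev.T M d).eval (x j) + 1) i)
      (2 ^ (d - 1) * (constraintMatrix (r.comp c) S).mulVec (fun j => b j ^ d) i) := by
  have hsum := ((const h r u (c ((a n (i.val.val + 1) 0 : ℚ) : K))).mono d.zero_le).add
    (sum (s := Finset.univ) fun j _ => (((hx j).eval_T hu d).add
      ((const h r u 1).mono d.zero_le)).const_mul (c ((a n (i.val.val + 1) (j.val + 1) : ℚ) : K)))
  simp only [Nat.sub_zero, hu, zero_pow hd.ne', zero_mul, add_zero, zero_add, map_one,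
    mul_left_comm _ (2 ^ (d - 1) : k), ← Finset.mul_sum] at hsum
  exact hsum

theorem constraintMatrix_mulVec_pow_eq_zero [CharZero k] (hh : Function.Injective h)
    (hρ : r (ρ Polynomial.X) = 0) (hu : r u = 0) (hd : 0 < d) (hf : ∀ i, (f i).totalDegree ≤ d)
    (hx : ∀ j, HasScaledReduction h r u 1 (x j) (b j))
    (hF : ∀ i, MvPolynomial.eval₂ (h.comp ρ) x (F d f S σ i) = 0) :
    (constraintMatrix (r.comp (ρ.comp Polynomial.C)) S).mulVec (fun j => b j ^ d) = 0 := by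
  funext i
  obtain ⟨b', hb'⟩ :=
    HasScaledReduction.exists_mvPolynomial_eval₂ (ρ.comp Polynomial.C) hx (hf i.val)
  have hzero := (hb'.const_mul (ρ Polynomial.X)).add (((HasScaledReduction.constraintForm
    (ρ.comp Polynomial.C) hu hd hx i).const_mul ((σ i : ℤ) : R)).const_mul (1 - ρ Polynomial.X))
  have hlhs := hF i
  rw [eval₂_F, RingHom.comp_assoc] at hlhs
  rw [map_sub h, map_one h, map_intCast h, ← RingHom.comp_apply h, hlhs] at hzero
  have hlead := hzero.eq_zero hh
  rw [hρ, zero_mul, zero_add, map_sub, map_one, hρ, sub_zero, one_mul, map_intCast] at hlead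
  have hσ : IsUnit ((σ i : ℤ) : k) := (σ i).isUnit.map (Int.castRingHom k)
  exact (mul_eq_zero.mp (hσ.mul_right_eq_zero.mp hlead)).resolve_left (pow_ne_zero _ two_ne_zero)

theorem multiplierMatrix_mulVec_eq_zero_of_ne_zero [CharZero k] {l : Option S → R}
    (hh : Function.Injective h)
    (hρ : r (ρ Polynomial.X) = 0) (hu : r u = 0) (hd : 0 < d) (hf : ∀ i, (f i).totalDegree ≤ d)
    (hg : g.totalDegree ≤ d) (hx : ∀ j, HasScaledReduction h r u 1 (x j) (b j)) {j : Fin n}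
    (hG : MvPolynomial.eval₂ (h.comp ρ) (Sum.elim x (h ∘ l)) (G d f g S σ j) = 0)
    (hb : b j ≠ 0) :
    (multiplierMatrix (r.comp (ρ.comp Polynomial.C)) σ).mulVec (r ∘ l) j = 0 := by
  have hpderiv {p : MvPolynomial (Fin n) K} (hp : p.totalDegree ≤ d) :=
    HasScaledReduction.exists_mvPolynomial_eval₂ (ρ.comp Polynomial.C) hx
      ((totalDegree_pderiv_le j p).trans (Nat.sub_le_sub_right hp 1))
  obtain ⟨b₀, hb₀⟩ := hpderiv hg
  choose b' hb' using fun i : S => hpderiv (hf i.val)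
  have hpart := (hb₀.const_mul (l none)).add ((HasScaledReduction.sum (s := Finset.univ)
    fun i _ => (hb' i).const_mul (l (some i))).const_mul (-1 : R))
  have hzero := (hpart.const_mul (ρ Polynomial.X)).add
    ((((hx j).eval_derivative_T hu hd).const_mul
      ((multiplierMatrix (ρ.comp Polynomial.C) σ).mulVec l j)).const_mul (1 - ρ Polynomial.X))
  rw [eval₂_G, RingHom.comp_assoc] at hG
  rw [map_neg h, map_one h, neg_one_mul, ← sub_eq_add_neg, map_sub h, map_one h,
    map_multiplierMatrix_mulVec h, ← RingHom.comp_apply h ρ] at hzero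
  have hlead := (hG ▸ hzero).eq_zero hh
  rw [hρ, zero_mul, zero_add, map_sub, map_one, hρ, sub_zero, one_mul,
    map_multiplierMatrix_mulVec] at hlead
  refine (mul_eq_zero.mp hlead).resolve_right ?_
  exact mul_ne_zero (mul_ne_zero (pow_ne_zero _ two_ne_zero) (Nat.cast_ne_zero.mpr hd.ne'))
    (pow_ne_zero _ hb)

/-- This is the absence of zeros at infinity over the point `t = 0`: there `b` would be the point at
which the zero `x = (x_j)` meets the hyperplane at infinity. -/
theorem eq_zero_of_hasScaledReduction [CharZero k] {l : Option S → R} (hh : Function.Injective h)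
    (hρ : r (ρ Polynomial.X) = 0) (hu : r u = 0) (hd : 0 < d) (hf : ∀ i, (f i).totalDegree ≤ d)
    (hg : g.totalDegree ≤ d) (hx : ∀ j, HasScaledReduction h r u 1 (x j) (b j))
    (hzero : IsSystemZero (h.comp ρ) d f g σ x (h ∘ l)) (hl : r ∘ l ≠ 0) : b = 0 := by
  classical
  have hconstraint := constraintMatrix_mulVec_pow_eq_zero hh hρ hu hd hf hx hzero.1
  have hcard : (Finset.univ.filter fun j => b j ≠ 0).card ≤ S.card :=
    (Finset.card_le_card (Finset.monotone_filter_right _ fun j _ hj =>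
      multiplierMatrix_mulVec_eq_zero_of_ne_zero hh hρ hu hd hf hg hx (hzero.2 j) hj)).trans
      (card_multiplierMatrix_mulVec_eq_zero_le _ σ hl)
  have hpow := eq_zero_of_constraintMatrix_mulVec_eq_zero _ hcard (fun j hj => ?_) hconstraint
  · exact funext fun j => (pow_eq_zero_iff hd.ne').mp (congrFun hpow j)
  · rw [of_not_not fun hb => hj (Finset.mem_filter.mpr ⟨Finset.mem_univ j, hb⟩),
      zero_pow hd.ne']

end Infinity

section LocalRing

variable {K R : Type*} [Field K] [CharZero K] [CommRing R] [IsLocalRing R] {n m d : ℕ}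
  {S : Finset (Fin m)} {σ : S → ℤˣ} {f : Fin m → MvPolynomial (Fin n) K}
  {g : MvPolynomial (Fin n) K} {ρ : K[X] →+* R}

theorem residue_comp_ne_zero {ι : Type*} {w : ι → R} {i : ι} (hi : w i = 1) :
    IsLocalRing.residue R ∘ w ≠ 0 := fun h =>
  one_ne_zero (by rw [← map_one (IsLocalRing.residue R), ← hi]; exact congrFun h i)

theorem charZero_residueField (ρ : K[X] →+* R) : CharZero (IsLocalRing.ResidueField R) :=
  charZero_of_injective_ringHom (((IsLocalRing.residue R).comp ρ).comp Polynomial.C).injective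

theorem IsSystemZero.isUnit_none {x : Fin n → R} {l : Option S → R}
    (hzero : IsSystemZero ρ d f g σ x l) (hρ : IsLocalRing.residue R (ρ Polynomial.X) = 0)
    (hd : 0 < d) (hl : IsLocalRing.residue R ∘ l ≠ 0) : IsUnit (l none) := by
  have := charZero_residueField ρ
  have hinitial := (isSystemZero_iff_of_map_X_eq_zero hρ).mp (hzero.map (IsLocalRing.residue R))
  exact IsLocalRing.residue_ne_zero_iff_isUnit _ |>.mp (hinitial.none_ne_zero hd hl)

end LocalRing

section Integrality

variable {K M : Type*} [Field K] [CharZero K] [Field M] {n m d : ℕ} {S : Finset (Fin m)}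
  {σ : S → ℤˣ} {f : Fin m → MvPolynomial (Fin n) K} {g : MvPolynomial (Fin n) K}
  {V : ValuationSubring M} {ρ : K[X] →+* V} {x : Fin n → M}

theorem IsSystemZero.mem_valuationSubring {w : Option S → V}
    (hzero : IsSystemZero (V.subtype.comp ρ) d f g σ x (V.subtype ∘ w))
    (hρ : IsLocalRing.residue V (ρ Polynomial.X) = 0) (hd : 0 < d)
    (hf : ∀ i, (f i).totalDegree ≤ d) (hg : g.totalDegree ≤ d)
    (hw : IsLocalRing.residue V ∘ w ≠ 0) (j : Fin n) : x j ∈ V := by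
  have := charZero_residueField ρ
  by_contra hj
  obtain ⟨b, z, hb, hxz, i, hi⟩ := exists_eq_mul_coe_and_exists_eq_one V fun h : x = 0 =>
    hj (by rw [h]; exact V.zero_mem)
  have hbV : b ∉ V := fun hbV => hj (by rw [hxz j]; exact V.mul_mem _ _ hbV (z j).2)
  let u : V := ⟨b⁻¹, (V.mem_or_inv_mem b).resolve_left hbV⟩
  have hu : IsLocalRing.residue V u = 0 := by
    rw [IsLocalRing.residue_eq_zero_iff, ← V.coe_mem_nonunits_iff]
    exact V.inv_mem_nonunits_iff.mpr (Or.inr hbV)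
  refine residue_comp_ne_zero hi (eq_zero_of_hasScaledReduction Subtype.val_injective hρ hu hd hf
    hg (fun j => ⟨z j, ?_, rfl⟩) hzero hw)
  rw [pow_one, hxz j]
  exact inv_mul_cancel_left₀ hb _

theorem IsSystemZero.exists_mem_affineZeros_of_ne_zero {l : Option S → M}
    (hzero : IsSystemZero (V.subtype.comp ρ) d f g σ x l)
    (hρ : IsLocalRing.residue V (ρ Polynomial.X) = 0) (hd : 0 < d)
    (hf : ∀ i, (f i).totalDegree ≤ d) (hg : g.totalDegree ≤ d) (hl : l ≠ 0) :
    l none ≠ 0 ∧ ∃ Q ∈ affineZeros ρ d f g S σ,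
      mapPoint V.subtype Q = (x, fun i => l (some i) / l none) := by
  obtain ⟨r, w, hr, hlw, o, ho⟩ := exists_eq_mul_coe_and_exists_eq_one V hl
  obtain rfl : l = r • (V.subtype ∘ w) := funext hlw
  rw [isSystemZero_smul_iff hr.isUnit] at hzero
  have hres := residue_comp_ne_zero ho
  lift x to Fin n → V using hzero.mem_valuationSubring hρ hd hf hg hres
  have hzeroV := (isSystemZero_map_iff Subtype.val_injective).mp hzero
  obtain ⟨v, hv⟩ := hzeroV.isUnit_none hρ hd hres
  have hdehom : dehom (fun i => (v⁻¹ : Vˣ) * w (some i)) = ((v⁻¹ : Vˣ) : V) • w :=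
    funext <| Option.rec (by rw [Pi.smul_apply, ← hv]; exact v.inv_mul.symm) fun _ => rfl
  have hw : V.subtype (w none) ≠ 0 := by
    rw [← hv]
    exact (v.isUnit.map V.subtype).ne_zero
  refine ⟨mul_ne_zero hr hw, (x, fun i => (v⁻¹ : Vˣ) * w (some i)), ?_,
    Prod.ext rfl (funext fun i => ?_)⟩
  · change IsSystemZero ρ d f g σ x _
    rw [hdehom]
    exact hzeroV.smul _
  · change V.subtype ((v⁻¹ : Vˣ) * w (some i)) = r * _ / (r * V.subtype (w none))
    rw [mul_div_mul_left _ _ hr, map_mul, map_units_inv, hv, div_eq_inv_mul]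
    rfl

end Integrality

section Lifting

variable {K R k : Type*} [Field K] [CommRing R] [Field k] {n m d : ℕ} {S : Finset (Fin m)}
  {σ : S → ℤˣ} {f : Fin m → MvPolynomial (Fin n) K} {g : MvPolynomial (Fin n) K}
  {ρ : K[X] →+* R} {h : R →+* k} {P Q : (Fin n → R) × (S → R)}

theorem map_jacobian {ι : Type*} (h : R →+* k) (p : ι → MvPolynomial ι R) (z : ι → R) :
    (jacobian p z).map h = jacobian (fun e => MvPolynomial.map h (p e)) (h ∘ z) := by
  ext e i
  simp only [jacobian, Matrix.map_apply, Matrix.of_apply, MvPolynomial.pderiv_map,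
    MvPolynomial.eval_map, MvPolynomial.eval₂_comp]

theorem exists_mapPoint_eq_of_finite [IsAlgClosed k] {L : Type*} [Field L] {ρ : K[X] →+* k}
    (φ : k →+* L) (hfin : (affineZeros ρ d f g S σ).Finite) {Q : (Fin n → L) × (S → L)}
    (hQ : Q ∈ affineZeros (φ.comp ρ) d f g S σ) :
    ∃ P ∈ affineZeros ρ d f g S σ, mapPoint φ P = Q := by
  obtain ⟨z, hz⟩ := exists_map_eq_of_finite_zeros φ
    (p := fun e => MvPolynomial.map ρ (system d f g σ e)) (y := Sum.elim Q.1 Q.2)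
    ((hfin.preimage (Equiv.sumArrowEquivProdArrow _ _ _).injective.injOn).subset
      fun z hz => mem_affineZeros_iff.mpr hz)
    fun e => by
      rw [MvPolynomial.eval₂_map, ← MvPolynomial.eval_map]
      exact mem_affineZeros_iff.mp hQ e
  have hmap : mapPoint φ (z ∘ Sum.inl, z ∘ Sum.inr) = Q :=
    Prod.ext (funext fun j => hz (Sum.inl j)) (funext fun i => hz (Sum.inr i))
  exact ⟨_, (mapPoint_mem_affineZeros_iff φ.injective).mp (hmap ▸ hQ), hmap⟩

theorem image_mapPoint_affineZeros_of_isAlgClosed [IsAlgClosed k] {L : Type*} [Field L]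
    {ρ : K[X] →+* k} (φ : k →+* L) (hfin : (affineZeros (φ.comp ρ) d f g S σ).Finite) :
    mapPoint φ '' affineZeros ρ d f g S σ = affineZeros (φ.comp ρ) d f g S σ := by
  refine Set.Subset.antisymm (Set.image_subset_iff.mpr fun P hP => mapPoint_mem_affineZeros φ hP)
    fun Q hQ => exists_mapPoint_eq_of_finite φ ?_ hQ
  exact (hfin.preimage (mapPoint_injective φ.injective).injOn).subset
    fun P hP => mapPoint_mem_affineZeros φ hP

variable [CharZero k] [IsLocalHom h]

theorem isUnit_det_jacobian_system (hρ : h (ρ Polynomial.X) = 0) (hd : 0 < d)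
    (hP : mapPoint h P ∈ affineZeros (h.comp ρ) d f g S σ) :
    IsUnit (jacobian (fun e => MvPolynomial.map ρ (system d f g σ e)) (Sum.elim P.1 P.2)).det := by
  refine isUnit_of_map_unit h _ ?_
  rw [RingHom.map_det, RingHom.mapMatrix_apply, map_jacobian, Sum.comp_elim]
  simp only [MvPolynomial.map_map]
  refine (det_jacobian_system_ne_zero hρ hd fun e => ?_).isUnit
  rw [← MvPolynomial.eval_map]
  exact mem_affineZeros_iff (z := Sum.elim (h ∘ P.1) (h ∘ P.2)) |>.mp hP e

theorem eq_of_mapPoint_eq [IsLocalRing R] (hρ : h (ρ Polynomial.X) = 0) (hd : 0 < d)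
    (hP : P ∈ affineZeros ρ d f g S σ) (hQ : Q ∈ affineZeros ρ d f g S σ)
    (hPQ : mapPoint h P = mapPoint h Q) : P = Q := by
  have hmem (y z : R) (hyz : h y = h z) : z - y ∈ IsLocalRing.maximalIdeal R := fun hunit =>
    (hunit.map h).ne_zero (by rw [map_sub, hyz, sub_self])
  refine (Equiv.sumArrowEquivProdArrow _ _ _).symm.injective
    (eq_of_isUnit_det_jacobian (mem_affineZeros_iff.mp hP) (mem_affineZeros_iff.mp hQ) ?_
      (isUnit_det_jacobian_system hρ hd (mapPoint_mem_affineZeros h hP)))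
  rintro (j | i)
  · exact hmem _ _ (congrFun (congrArg Prod.fst hPQ) j)
  · exact hmem _ _ (congrFun (congrArg Prod.snd hPQ) i)

theorem exists_mem_affineZeros_mapPoint_eq [IsAdicComplete (RingHom.ker h) R]
    (hh : Function.Surjective h) (hρ : h (ρ Polynomial.X) = 0) (hd : 0 < d)
    {p : (Fin n → k) × (S → k)} (hp : p ∈ affineZeros (h.comp ρ) d f g S σ) :
    ∃ w ∈ affineZeros ρ d f g S σ, mapPoint h w = p := by
  obtain ⟨P, rfl⟩ : ∃ P, mapPoint h P = p :=
    Prod.map_surjective.mpr ⟨hh.comp_left, hh.comp_left⟩ p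
  have hker (e) :
      MvPolynomial.eval (Sum.elim P.1 P.2) (MvPolynomial.map ρ (system d f g σ e)) ∈
        RingHom.ker h := by
    rw [RingHom.mem_ker, MvPolynomial.eval_map, MvPolynomial.eval₂_comp_left, Sum.comp_elim,
      ← MvPolynomial.eval_map]
    exact mem_affineZeros_iff (z := Sum.elim (h ∘ P.1) (h ∘ P.2)) |>.mp hp e
  obtain ⟨z, hz, hzP⟩ := exists_zero_of_isUnit_det_jacobian (RingHom.ker h) hker
    (isUnit_det_jacobian_system hρ hd hp)
  have hz_map (e) : h (z e) = h (Sum.elim P.1 P.2 e) :=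
    sub_eq_zero.mp ((map_sub h _ _).symm.trans (hzP e))
  exact ⟨_, mem_affineZeros_iff.mpr hz,
    Prod.ext (funext fun j => hz_map (Sum.inl j)) (funext fun i => hz_map (Sum.inr i))⟩

end Lifting

section PowerSeries

variable {k : Type*} [Field k]

instance isLocalHom_constantCoeff : IsLocalHom (PowerSeries.constantCoeff (R := k)) :=
  ⟨fun _ => PowerSeries.isUnit_iff_constantCoeff.mpr⟩

instance isAdicComplete_ker_constantCoeff :
    IsAdicComplete (RingHom.ker (PowerSeries.constantCoeff (R := k))) (PowerSeries k) := by
  rw [show RingHom.ker (PowerSeries.constantCoeff (R := k)) = Ideal.span {PowerSeries.X} from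
    Ideal.ext fun s => by rw [RingHom.mem_ker, Ideal.mem_span_singleton, PowerSeries.X_dvd_iff]]
  infer_instance

end PowerSeries

section Fields

variable (K : Type*) [Field K]

theorem toSeries_X : toSeries K Polynomial.X = PowerSeries.X := by
  simp [toSeries]

theorem toSeries_C (r : K) :
    toSeries K (Polynomial.C r) = PowerSeries.C (algebraMap K (AlgebraicClosure K) r) := by
  simp [toSeries]

theorem constantCoeff_comp_toSeries_X :
    PowerSeries.constantCoeff (toSeries K Polynomial.X) = 0 := by
  rw [toSeries_X, PowerSeries.constantCoeff_X]

theorem constantCoeff_comp_toSeries_comp_C :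
    (PowerSeries.constantCoeff.comp (toSeries K)).comp Polynomial.C =
      algebraMap K (AlgebraicClosure K) :=
  RingHom.ext fun r => by
    rw [RingHom.comp_apply, RingHom.comp_apply, toSeries_C, PowerSeries.constantCoeff_C]

theorem toSeries_injective : Function.Injective (toSeries K) :=
  (Polynomial.coe_injective (AlgebraicClosure K)).comp
    (Polynomial.map_injective _ (algebraMap K (AlgebraicClosure K)).injective)

theorem seriesToBig_injective : Function.Injective (seriesToBig K) :=
  (algebraMap (LaurentSeries (AlgebraicClosure K)) (BigField K)).injective.comp
    HahnSeries.ofPowerSeries_injective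

theorem exists_comp_toOmega_eq :
    ∃ φ : Omega K →+* BigField K, φ.comp (toOmega K) = (seriesToBig K).comp (toSeries K) := by
  let ψ : RatFunc K →+* BigField K := IsFractionRing.lift (A := K[X])
    (g := (seriesToBig K).comp (toSeries K)) ((seriesToBig_injective K).comp (toSeries_injective K))
  let := ψ.toAlgebra
  let φ : Omega K →ₐ[RatFunc K] BigField K := IsAlgClosed.lift
  refine ⟨φ, RingHom.ext fun p => (φ.commutes _).trans ?_⟩
  exact IsFractionRing.lift_algebraMap _ p

end Fields

section InitialZeros

variable {K L : Type*} [Field K] [CharZero K] [Field L] [IsAlgClosed L] {n m d : ℕ}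
  {S : Finset (Fin m)} {f : Fin m → MvPolynomial (Fin n) K} {g : MvPolynomial (Fin n) K}
  {ρ : K[X] →+* L}

theorem finite_and_natCard_affineZeros_of_map_X_eq_zero (hρ : ρ Polynomial.X = 0) (hd : 0 < d)
    (σ : S → ℤˣ) :
    Finite (affineZeros ρ d f g S σ) ∧
      Nat.card (affineZeros ρ d f g S σ) = bezoutNumber n d S.card := by
  have : CharZero L := charZero_of_injective_ringHom (ρ.comp Polynomial.C).injective
  rw [show affineZeros ρ d f g S σ =
      {P | IsInitialZero (ρ.comp Polynomial.C) d σ P.1 (dehom P.2)} from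
    Set.ext fun P => isSystemZero_iff_of_map_X_eq_zero hρ]
  exact finite_and_natCard_isInitialZero hd σ

end InitialZeros

theorem exists_comp_eq_residue_comp {R k A : Type*} [CommRing R] [Field k] [CommRing A]
    [IsLocalRing A] {h : R →+* k} (hh : Function.Surjective h) (χ : R →+* A) [IsLocalHom χ] :
    ∃ θ : k →+* IsLocalRing.ResidueField A, θ.comp h = (IsLocalRing.residue A).comp χ := by
  refine ⟨h.liftOfSurjective hh ⟨(IsLocalRing.residue A).comp χ, fun r hr => ?_⟩,
    h.liftOfSurjective_comp hh _⟩
  rw [RingHom.mem_ker, RingHom.comp_apply, IsLocalRing.residue_eq_zero_iff]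
  exact fun hunit => ((isUnit_of_map_unit χ r hunit).map h).ne_zero hr

section CompleteLocalRing

variable {K R k M : Type*} [Field K] [CharZero K] [CommRing R] [IsLocalRing R] [Field k] [Field M]
  {n m d : ℕ} {S : Finset (Fin m)} {σ : S → ℤˣ} {f : Fin m → MvPolynomial (Fin n) K}
  {g : MvPolynomial (Fin n) K} {ρ : K[X] →+* R} {h : R →+* k} [IsLocalHom h]

theorem fst_injOn_affineZeros (hρ : h (ρ Polynomial.X) = 0) (hd : 0 < d) :
    Set.InjOn Prod.fst (affineZeros ρ d f g S σ) := by
  have : CharZero k := charZero_of_injective_ringHom ((h.comp ρ).comp Polynomial.C).injective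
  intro P hP Q hQ hPQ
  have hinitial {P} (hP : P ∈ affineZeros ρ d f g S σ) :=
    (isSystemZero_iff_of_map_X_eq_zero hρ).mp (mapPoint_mem_affineZeros h hP)
  have hfst : (mapPoint h P).1 = (mapPoint h Q).1 := congrArg (h ∘ ·) hPQ
  exact eq_of_mapPoint_eq hρ hd hP hQ <| Prod.ext hfst <|
    isInitialZero_dehom_inj hd (hfst ▸ hinitial hP) (hinitial hQ)

variable [IsAdicComplete (RingHom.ker h) R]

theorem mapPoint_bijOn_affineZeros (hh : Function.Surjective h) (hρ : h (ρ Polynomial.X) = 0)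
    (hd : 0 < d) :
    Set.BijOn (mapPoint h) (affineZeros ρ d f g S σ) (affineZeros (h.comp ρ) d f g S σ) := by
  have : CharZero k := charZero_of_injective_ringHom ((h.comp ρ).comp Polynomial.C).injective
  exact ⟨fun P hP => mapPoint_mem_affineZeros h hP,
    fun P hP Q hQ => eq_of_mapPoint_eq hρ hd hP hQ,
    fun p hp => exists_mem_affineZeros_mapPoint_eq hh hρ hd hp⟩

variable [IsAlgClosed k]

theorem finite_and_natCard_affineZeros (hh : Function.Surjective h) (hρ : h (ρ Polynomial.X) = 0)
    (hd : 0 < d) (f : Fin m → MvPolynomial (Fin n) K) (g : MvPolynomial (Fin n) K) (σ : S → ℤˣ) :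
    Finite (affineZeros ρ d f g S σ) ∧
      Nat.card (affineZeros ρ d f g S σ) = bezoutNumber n d S.card := by
  let e := (mapPoint_bijOn_affineZeros (f := f) (g := g) (σ := σ) hh hρ hd).equiv
  rw [Nat.card_congr e, e.finite_iff]
  exact finite_and_natCard_affineZeros_of_map_X_eq_zero hρ hd σ

theorem IsSystemZero.exists_mem_affineZeros_mapPoint_eq {ψ : R →+* M} {x : Fin n → M}
    {l : Option S → M} (hzero : IsSystemZero (ψ.comp ρ) d f g σ x l)
    (hh : Function.Surjective h) (hρ : h (ρ Polynomial.X) = 0) (hd : 0 < d)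
    (hf : ∀ i, (f i).totalDegree ≤ d) (hg : g.totalDegree ≤ d) (hl : l ≠ 0) :
    l none ≠ 0 ∧ ∃ w ∈ affineZeros ρ d f g S σ,
      mapPoint ψ w = (x, fun i => l (some i) / l none) := by
  obtain ⟨V, hV, hlocal⟩ := IsLocalRing.exists_factor_valuationRing ψ
  let χ : R →+* V := ψ.codRestrict V.toSubring hV
  obtain ⟨θ, hθ⟩ := exists_comp_eq_residue_comp hh χ
  have hρV : IsLocalRing.residue V ((χ.comp ρ) Polynomial.X) = 0 :=
    (RingHom.congr_fun hθ _).symm.trans ((congrArg θ hρ).trans (map_zero θ))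
  obtain ⟨hl_none, Q, hQ, hQx⟩ :=
    IsSystemZero.exists_mem_affineZeros_of_ne_zero (ρ := χ.comp ρ) hzero hρV hd hf hg hl
  have hQ_residue := mapPoint_mem_affineZeros (IsLocalRing.residue V) hQ
  rw [← RingHom.comp_assoc, ← hθ, RingHom.comp_assoc] at hQ_residue
  obtain ⟨p, hp, hpQ⟩ := exists_mapPoint_eq_of_finite θ
    (finite_and_natCard_affineZeros_of_map_X_eq_zero hρ hd σ).1 hQ_residue
  obtain ⟨w, hw, rfl⟩ := (mapPoint_bijOn_affineZeros hh hρ hd).surjOn hp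
  have hwQ : mapPoint χ w = Q := by
    have := charZero_residueField (χ.comp ρ)
    refine eq_of_mapPoint_eq (h := IsLocalRing.residue V) hρV hd (mapPoint_mem_affineZeros χ hw)
      hQ (Eq.trans ?_ hpQ)
    change mapPoint ((IsLocalRing.residue V).comp χ) w = mapPoint (θ.comp h) w
    rw [hθ]
  exact ⟨hl_none, w, hw, by rw [← hQx, ← hwQ]; rfl⟩

end CompleteLocalRing

section Projective

variable {K Ω : Type*} [Field K] [Field Ω] {n m d : ℕ} {S : Finset (Fin m)} {σ : S → ℤˣ}
  {f : Fin m → MvPolynomial (Fin n) K} {g : MvPolynomial (Fin n) K} {ρ : K[X] →+* Ω}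

/-- The point of `𝔸ⁿ × ℙˢ` with the homogeneous coordinates `λ₀ = 1` and `λ_i`, `i ∈ S`. -/
noncomputable def toProjective (P : (Fin n → Ω) × (S → Ω)) :
    (Fin n → Ω) × Projectivization Ω (Option S → Ω) :=
  (P.1, Projectivization.mk Ω (dehom P.2) (dehom_ne_zero P.2))

theorem exists_smul_dehom_eq_rep_toProjective (P : (Fin n → Ω) × (S → Ω)) :
    ∃ u : Ωˣ, u • dehom P.2 = (toProjective P).2.rep :=
  Projectivization.exists_smul_eq_mk_rep Ω (dehom P.2) (dehom_ne_zero P.2)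

theorem rep_toProjective_none_ne_zero (P : (Fin n → Ω) × (S → Ω)) :
    (toProjective P).2.rep none ≠ 0 := by
  obtain ⟨u, hu⟩ := exists_smul_dehom_eq_rep_toProjective P
  rw [← hu]
  exact mul_ne_zero u.ne_zero one_ne_zero

theorem rep_toProjective_some_div_none (P : (Fin n → Ω) × (S → Ω)) (i : S) :
    (toProjective P).2.rep (some i) / (toProjective P).2.rep none = P.2 i := by
  obtain ⟨u, hu⟩ := exists_smul_dehom_eq_rep_toProjective P
  rw [← hu]
  exact (mul_div_mul_left _ _ u.ne_zero).trans (div_one _)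

theorem smul_dehom_div_none {l : Option S → Ω} (hl : l none ≠ 0) :
    l none • dehom (fun i => l (some i) / l none) = l :=
  funext <| Option.rec (mul_one _) fun _ => mul_div_cancel₀ _ hl

theorem image_toProjective_affineZeros
    (hnone : ∀ x l, IsSystemZero ρ d f g σ x l → l ≠ 0 → l none ≠ 0) :
    toProjective '' affineZeros ρ d f g S σ = variety Ω ρ d f g S σ := by
  ext ⟨x, p⟩
  constructor
  · rintro ⟨P, hP, hPx⟩
    rw [← hPx]
    obtain ⟨u, hu⟩ := exists_smul_dehom_eq_rep_toProjective P
    exact show IsSystemZero ρ d f g σ P.1 _ from hu ▸ IsSystemZero.smul hP (u : Ω)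
  · intro hzero
    have hp := hnone x p.rep hzero p.rep_nonzero
    refine ⟨(x, fun i => p.rep (some i) / p.rep none), ?_, Prod.ext rfl ?_⟩
    · exact (isSystemZero_smul_iff hp.isUnit).mp ((smul_dehom_div_none hp).symm ▸ hzero)
    · refine Eq.trans ?_ p.mk_rep
      exact ((Projectivization.mk_eq_mk_iff' Ω _ _ _ _).mpr ⟨_, smul_dehom_div_none hp⟩).symm

end Projective

section Enumeration

variable {K R k M Ω : Type*} [Field K] [CharZero K] [CommRing R] [IsLocalRing R] [Field k]
  [Field M] [Field Ω] {n m d : ℕ} {S : Finset (Fin m)} {σ : S → ℤˣ}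
  {f : Fin m → MvPolynomial (Fin n) K} {g : MvPolynomial (Fin n) K} {ρ : K[X] →+* R}
  {τ : K[X] →+* Ω} {h : R →+* k} {ψ : R →+* M} {φ : Ω →+* M} [IsLocalHom h]
  [IsAdicComplete (RingHom.ker h) R] [IsAlgClosed k]

theorem image_mapPoint_affineZeros_of_isAdicComplete (ψ : R →+* M) (hh : Function.Surjective h)
    (hρ : h (ρ Polynomial.X) = 0) (hd : 0 < d) (hf : ∀ i, (f i).totalDegree ≤ d)
    (hg : g.totalDegree ≤ d) :
    mapPoint ψ '' affineZeros ρ d f g S σ = affineZeros (ψ.comp ρ) d f g S σ := by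
  refine Set.Subset.antisymm (Set.image_subset_iff.mpr fun w hw => mapPoint_mem_affineZeros ψ hw)
    fun P hP => ?_
  obtain ⟨-, w, hw, hwP⟩ := IsSystemZero.exists_mem_affineZeros_mapPoint_eq hP hh hρ hd hf hg
    (dehom_ne_zero P.2)
  exact ⟨w, hw, hwP.trans (Prod.ext rfl (funext fun i => div_one _))⟩

theorem image_mapPoint_affineZeros_eq [IsAlgClosed Ω] (hφ : φ.comp τ = ψ.comp ρ)
    (hh : Function.Surjective h) (hρ : h (ρ Polynomial.X) = 0) (hd : 0 < d)
    (hf : ∀ i, (f i).totalDegree ≤ d) (hg : g.totalDegree ≤ d) :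
    mapPoint φ '' affineZeros τ d f g S σ = mapPoint ψ '' affineZeros ρ d f g S σ := by
  have hψ := image_mapPoint_affineZeros_of_isAdicComplete (σ := σ) ψ hh hρ hd hf hg
  have := (finite_and_natCard_affineZeros hh hρ hd f g σ).1
  rw [image_mapPoint_affineZeros_of_isAlgClosed, hψ, hφ]
  rw [hφ, ← hψ]
  exact Set.toFinite _

theorem exists_enumeration_affineZeros [IsAlgClosed Ω] (hφ : φ.comp τ = ψ.comp ρ)
    (hh : Function.Surjective h) (hρ : h (ρ Polynomial.X) = 0) (hd : 0 < d)
    (hf : ∀ i, (f i).totalDegree ≤ d) (hg : g.totalDegree ≤ d) (σ : S → ℤˣ) :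
    ∃ (P : Fin (bezoutNumber n d S.card) → (Fin n → Ω) × (S → Ω))
      (w : Fin (bezoutNumber n d S.card) → (Fin n → R) × (S → R)),
      Set.range P = affineZeros τ d f g S σ ∧ Set.range w = affineZeros ρ d f g S σ ∧
      Function.Injective w ∧ ∀ k, mapPoint φ (P k) = mapPoint ψ (w k) := by
  have himage := image_mapPoint_affineZeros_eq (σ := σ) hφ hh hρ hd hf hg
  obtain ⟨hfin, hcard⟩ := finite_and_natCard_affineZeros hh hρ hd f g σ
  let e := (Finite.equivFinOfCardEq hcard).symm
  have hw : Set.range (fun k => (e k).val) = affineZeros ρ d f g S σ :=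
    (e.surjective.range_comp Subtype.val).trans Subtype.range_val
  choose P hP hPw using fun k => himage.ge (Set.mem_image_of_mem _ (e k).property)
  refine ⟨P, fun k => (e k).val, ?_, hw, Subtype.val_injective.comp e.injective, hPw⟩
  refine Set.Subset.antisymm (Set.range_subset_iff.mpr hP) fun Q hQ => ?_
  obtain ⟨_, hv, hvQ⟩ := himage.le (Set.mem_image_of_mem _ hQ)
  obtain ⟨k, rfl⟩ := hw.ge hv
  exact ⟨k, mapPoint_injective φ.injective ((hPw k).trans hvQ)⟩

theorem image_toProjective_affineZeros_eq_variety (hφ : φ.comp τ = ψ.comp ρ)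
    (hh : Function.Surjective h) (hρ : h (ρ Polynomial.X) = 0) (hd : 0 < d)
    (hf : ∀ i, (f i).totalDegree ≤ d) (hg : g.totalDegree ≤ d) :
    toProjective '' affineZeros τ d f g S σ = variety Ω τ d f g S σ := by
  refine image_toProjective_affineZeros fun x l hzero hl hl_none => ?_
  have hzeroM := hzero.map φ
  rw [hφ] at hzeroM
  refine (hzeroM.exists_mem_affineZeros_mapPoint_eq hh hρ hd hf hg fun hφl => hl ?_).1 ?_
  · exact φ.injective.comp_left (hφl.trans (funext fun _ => (map_zero φ).symm))
  · exact (congrArg φ hl_none).trans (map_zero φ)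

end Enumeration

section Series

variable {K : Type*} [Field K] {n m d : ℕ} {S : Finset (Fin m)} {σ : S → ℤˣ}
  {f : Fin m → MvPolynomial (Fin n) K} {g : MvPolynomial (Fin n) K}

theorem affineZeros_constantCoeff_comp_toSeries :
    affineZeros (PowerSeries.constantCoeff.comp (toSeries K)) d f g S σ =
      initialZeros (K := K) (AlgebraicClosure K) n d S σ := by
  ext P
  rw [mem_initialZeros_iff, ← constantCoeff_comp_toSeries_comp_C]
  exact isSystemZero_iff_of_map_X_eq_zero (constantCoeff_comp_toSeries_X K)

theorem atZero_bijOn_affineZeros [CharZero K] (hd : 0 < d) :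
    Set.BijOn (atZero K) (affineZeros (toSeries K) d f g S σ)
      (initialZeros (K := K) (AlgebraicClosure K) n d S σ) := by
  rw [← affineZeros_constantCoeff_comp_toSeries (f := f) (g := g)]
  exact mapPoint_bijOn_affineZeros PowerSeries.constantCoeff_surj (constantCoeff_comp_toSeries_X K)
    hd

end Series

end Deformation

theorem mainTheorem6_general {K : Type*} [Field K] [CharZero K] (n m d : ℕ) (hd : 0 < d)
    (f : Fin m → MvPolynomial (Fin n) K) (hf : ∀ i, (f i).totalDegree ≤ d)
    (g : MvPolynomial (Fin n) K) (hg : g.totalDegree ≤ d)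
    (S : Finset (Fin m)) (σ : S → ℤˣ) :
    ∃ (W : Fin (Deformation.bezoutNumber n d S.card) →
        (Fin n → Deformation.Omega K) ×
          Projectivization (Deformation.Omega K) (Option S → Deformation.Omega K))
      (Ws : Fin (Deformation.bezoutNumber n d S.card) →
        (Fin n → Deformation.Series K) × (S → Deformation.Series K))
      (φ : Deformation.Omega K →+* Deformation.BigField K),
      Set.range W =
        Deformation.variety (Deformation.Omega K) (Deformation.toOmega K) d f g S σ ∧
      Function.Injective W ∧
      (∀ k, (W k).2.rep none ≠ 0) ∧
      Function.Injective (fun k => (W k).1) ∧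
      (∀ c, φ (Deformation.toOmega K c) =
        Deformation.seriesToBig K (Deformation.toSeries K c)) ∧
      (∀ k j, φ ((W k).1 j) = Deformation.seriesToBig K ((Ws k).1 j)) ∧
      (∀ k i, φ ((W k).2.rep (some i) / (W k).2.rep none) =
        Deformation.seriesToBig K ((Ws k).2 i)) ∧
      Set.range Ws = Deformation.affineZeros (Deformation.toSeries K) d f g S σ ∧
      Function.Injective (fun k => Deformation.atZero K (Ws k)) ∧
      Set.range (fun k => Deformation.atZero K (Ws k)) =
        Deformation.initialZeros (K := K) (AlgebraicClosure K) n d S σ := by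
  open Deformation in
  obtain ⟨φ, hφ⟩ := exists_comp_toOmega_eq K
  have hsurj := PowerSeries.constantCoeff_surj (R := AlgebraicClosure K)
  have hX := constantCoeff_comp_toSeries_X K
  obtain ⟨P, w, hP, hw, hw_inj, hPw⟩ :=
    exists_enumeration_affineZeros hφ hsurj hX hd hf hg σ
  have hPw_fst (k j) : φ ((P k).1 j) = seriesToBig K ((w k).1 j) :=
    congrFun (congrArg Prod.fst (hPw k)) j
  have hatZero := atZero_bijOn_affineZeros (f := f) (g := g) (σ := σ) hd
  have hfst : Function.Injective fun k => (P k).1 := fun k k' hkk' => hw_inj <|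
    fst_injOn_affineZeros hX hd (hw ▸ Set.mem_range_self k) (hw ▸ Set.mem_range_self k') <|
      funext fun j => seriesToBig_injective K <| by
        rw [← hPw_fst, ← hPw_fst]
        exact congrArg φ (congrFun hkk' j)
  refine ⟨toProjective ∘ P, w, φ, ?_, .of_comp (f := Prod.fst) (g := toProjective ∘ P) hfst,
    fun k => rep_toProjective_none_ne_zero (P k), hfst, RingHom.congr_fun hφ, hPw_fst,
    fun k i => ?_, hw, ?_, ?_⟩
  · rw [Set.range_comp, hP, image_toProjective_affineZeros_eq_variety hφ hsurj hX hd hf hg]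
  · rw [Function.comp_apply, rep_toProjective_some_div_none]
    exact congrFun (congrArg Prod.snd (hPw k)) i
  · exact fun k k' hkk' => hw_inj <|
      hatZero.injOn (hw ▸ Set.mem_range_self k) (hw ▸ Set.mem_range_self k') hkk'
  · rw [← hatZero.image_eq, ← hw, ← Set.range_comp]
    rfl

theorem mainTheorem6 {K : Type*} [Field K] [CharZero K] (n m d : ℕ) (hn : 1 ≤ n)
    (hd : Even d) (hd0 : 0 < d)
    (f : Fin m → MvPolynomial (Fin n) K) (hf : ∀ i, (f i).totalDegree ≤ d)
    (g : MvPolynomial (Fin n) K) (hg : g.totalDegree ≤ d)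
    (S : Finset (Fin m)) (hS : S.card ≤ n) (σ : S → ℤˣ) :
    ∃ (W : Fin (Deformation.bezoutNumber n d S.card) →
        (Fin n → Deformation.Omega K) ×
          Projectivization (Deformation.Omega K) (Option S → Deformation.Omega K))
      (Ws : Fin (Deformation.bezoutNumber n d S.card) →
        (Fin n → Deformation.Series K) × (S → Deformation.Series K))
      (φ : Deformation.Omega K →+* Deformation.BigField K),
      -- the variety is the finite set of the `D_s` distinct points `W k`
      Set.range W =
        Deformation.variety (Deformation.Omega K) (Deformation.toOmega K) d f g S σ ∧
      Function.Injective W ∧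
      -- the points lie in `λ₀ ≠ 0`, and their projections to the `x`-space are distinct
      (∀ k, (W k).2.rep none ≠ 0) ∧
      Function.Injective (fun k => (W k).1) ∧
      -- `φ` is an embedding over `K[t]`, and it identifies `W k` with a power series point
      (∀ c, φ (Deformation.toOmega K c) =
        Deformation.seriesToBig K (Deformation.toSeries K c)) ∧
      (∀ k j, φ ((W k).1 j) = Deformation.seriesToBig K ((Ws k).1 j)) ∧
      (∀ k i, φ ((W k).2.rep (some i) / (W k).2.rep none) =
        Deformation.seriesToBig K ((Ws k).2 i)) ∧
      -- the power series points are the zeros of the deformed system over the power series ring,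
      -- and each zero of the system at `t = 0` lifts to exactly one of them
      Set.range Ws = Deformation.affineZeros (Deformation.toSeries K) d f g S σ ∧
      Function.Injective (fun k => Deformation.atZero K (Ws k)) ∧
      Set.range (fun k => Deformation.atZero K (Ws k)) =
        Deformation.initialZeros (K := K) (AlgebraicClosure K) n d S σ :=
  mainTheorem6_general n m d hd0 f hf g hg S σ
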